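/- **Model.** Fix integers $M\ge 2$ and $L\ge 1$, rewards $0<r_1<\dots<r_M$, a holding cost $h>0$, and probabilities $\lambda_0,\dots,\lambda_M\ge 0$ with $\sum_{j=0}^M\lambda_j=1$. Time is divided into replenishment cycles of $T\ge 1$ periods. In each period, independently, one customer of type $j\in\{1,\dots,M\}$ arrives with probability $\lambda_j$, and nobody arrives with probability $\lambda_0$. Serving a type-$j$ customer uses one unit of inventory and earns $r_j$; customers who are not served are lost. The cycle's profit is the collected reward minus $h$ times the end-of-cycle inventory. At the start of every cycle, a base-stock policy with level $S\in\mathbb N$ places the order that raises the inventory position (on-hand inventory plus outstanding orders) to $S$; this order arrives $L$ cycles later. The initial state is an arbitrary nonnegative integer state with inventory position at most $S$, possibly depending on the fulfillment algorithm, on $T$ and on $S$. Two fulfillment algorithms are considered. *Myopic offline* knows all arrivals of the current cycle and serves them from the highest type to the lowest until inventory runs out. *Online greedy* serves every arriving customer as long as inventory is available. For $\mathrm{alg}\in\{\mathrm{off},\mathrm{greedy}\}$ let $\pi_{\mathbf b}^{\mathrm{alg}}(T,S,N)$ be the expected average profit per cycle over $N$ cycles, let $\pi_{\mathbf b}^{\mathrm{alg}}(T,S,\infty)=\lim_{N\to\infty}\pi_{\mathbf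 b}^{\mathrm{alg}}(T,S,N)$, let $S^{\mathrm{alg}}=S^{\mathrm{alg}}(T)$ be a maximizer of $S\mapsto\pi_{\mathbf b}^{\mathrm{alg}}(T,S,\infty)$ over $S\in\mathbb N$, and put $\pi_{\mathbf b}^{\mathrm{alg}}=\pi_{\mathbf b}^{\mathrm{alg}}(T,S^{\mathrm{alg}},\infty)$. Put $\Delta_T^{\mathrm{off}}=(L+1)T(1-\lambda_0)-S^{\mathrm{off}}$. Say that $T$ is *interior* if $(L+1)T\lambda_M<S^{\mathrm{off}}(T)<(L+1)T(1-\lambda_0)$. Write $I_1^{\infty,S}$ for the start-of-cycle on-hand inventory under a stationary distribution of the inventory state (on-hand inventory and outstanding orders) for base-stock level $S$. **Theorem.** The limits $\pi_{\mathbf b}^{\mathrm{alg}}(T,S,\infty)$ exist for both algorithms and all $T\ge1$ and $S$. Moreover: 1. There is a finite constant $K_2$, independent of $T$, such that for every interior $T$ a stationary distribution exists for $S=S^{\mathrm{off}}$ under each of the two algorithms, every such stationary distribution satisfies $$\mathbb E\left|I_1^{\infty,S^{\mathrm{off}}}-\frac{S^{\mathrm{off}}}{L+1}\right|\le K_2\sqrt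 T,$$ and $$\pi_{\mathbf b}^{\mathrm{off}}-\pi_{\mathbf b}^{\mathrm{greedy}}\le (r_M-r_1)\,\frac{1-\lambda_0-\lambda_1}{1-\lambda_0}\left(\frac{\Delta_T^{\mathrm{off}}}{L+1}+\Bigl(K_2+\sqrt{(1-\lambda_0)\lambda_0}\Bigr)\sqrt T\right).$$ 2. The last inequality holds, more generally, for every interior $T$ and every real $K_2$ for which the first inequality holds at this $T$ for some stationary distribution under one of the two algorithms. 3. If all sufficiently large $T$ are interior and $\Delta_T^{\mathrm{off}}=\Theta(T^\beta)$ as $T\to\infty$ for some $\beta\in[0,1]$, then $\pi_{\mathbf b}^{\mathrm{off}}-\pi_{\mathbf b}^{\mathrm{greedy}}=O(T^\beta+\sqrt T)$ as $T\to\infty$. -/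

import Mathlib

open Filter Topology Asymptotics

noncomputable section

namespace BaseStock

/-- The two fulfillment algorithms: myopic offline (knows the arrivals of the current cycle)
and online greedy. -/
inductive Fulfillment
  | offline
  | greedy

/-- The arrivals of one cycle of `T` periods: `ω t = 0` means that nobody arrives in period `t`,
and `ω t = j ≥ 1` means that a customer of type `j` arrives. -/
abbrev CyclePath (M T : ℕ) := Fin T → Fin (M + 1)

/-- Probability of a cycle path when periods are i.i.d. with law `lam`. -/
def pathProb {M T : ℕ} (lam : Fin (M + 1) → ℝ) (ω : CyclePath M T) : ℝ :=
  ∏ t, lam (ω t)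

/-- Myopic offline fulfillment: customers of the cycle are served from the highest type to the
lowest one (within a type, in order of arrival) until the `I` units are used up. So a customer is
served iff fewer than `I` customers come before it in this priority order. -/
def offlineAccepted {M T : ℕ} (I : ℕ) (ω : CyclePath M T) : Finset (Fin T) :=
  Finset.univ.filter fun t => ω t ≠ 0 ∧
    (Finset.univ.filter fun s => ω t < ω s ∨ (ω s = ω t ∧ s < t)).card < I

/-- On-hand inventory of online greedy after `t` periods of a cycle started with `I` units:
every arriving customer is served while there is stock. -/
def greedyStock {M T : ℕ} (I : ℕ) (ω : CyclePath M T) : ℕ → ℕ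
  | 0 => I
  | t + 1 =>
    if ht : t < T then
      if ω ⟨t, ht⟩ ≠ 0 ∧ 0 < greedyStock I ω t then greedyStock I ω t - 1
      else greedyStock I ω t
    else greedyStock I ω t

/-- Periods in which online greedy serves a customer. -/
def greedyAccepted {M T : ℕ} (I : ℕ) (ω : CyclePath M T) : Finset (Fin T) :=
  Finset.univ.filter fun t => ω t ≠ 0 ∧ 0 < greedyStock I ω t

/-- Periods of a cycle in which a customer is served, given start-of-cycle inventory `I`. -/
def accepted {M T : ℕ} (a : Fulfillment) (I : ℕ) (ω : CyclePath M T) : Finset (Fin T) :=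
  match a with
  | .offline => offlineAccepted I ω
  | .greedy => greedyAccepted I ω

/-- End-of-cycle inventory (at most `I` customers are served, so nothing is truncated). -/
def leftover {M T : ℕ} (a : Fulfillment) (I : ℕ) (ω : CyclePath M T) : ℕ :=
  I - (accepted a I ω).card

/-- Profit of a cycle: collected rewards minus holding cost on the end-of-cycle inventory. -/
def cycleProfit {M T : ℕ} (a : Fulfillment) (r : Fin (M + 1) → ℝ) (h : ℝ) (I : ℕ)
    (ω : CyclePath M T) : ℝ :=
  ∑ t ∈ accepted a I ω, r (ω t) - h * (leftover a I ω : ℝ)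

/-- The feasible inventory states at the start of a cycle, before ordering, for base-stock level
`S`. A state `z` lists the on-hand inventory `z 0` and the outstanding orders
`z 1, …, z (L - 1)`, where `z i` arrives `i` cycles later; its inventory position is at most `S`. -/
def feasibleStates (L S : ℕ) : Finset (Fin L → ℕ) :=
  (Fintype.piFinset fun _ => Finset.range (S + 1)).filter fun z => ∑ i, z i ≤ S

/-- The order placed by the base-stock policy; it arrives `L` cycles later. -/
def orderQty {L : ℕ} (S : ℕ) (z : Fin L → ℕ) : ℕ := S - ∑ i, z i

/-- State at the start of the next cycle: the pipeline, with the new order appended at its end,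
moves one cycle ahead, and the arriving order joins the leftover of the current cycle. -/
def nextState {M T L : ℕ} [NeZero L] (a : Fulfillment) (S : ℕ) (z : Fin L → ℕ)
    (ω : CyclePath M T) : Fin L → ℕ := fun i =>
  (Fin.snoc (α := fun _ => ℕ) z (orderQty S z) : Fin (L + 1) → ℕ) i.succ +
    if i = 0 then leftover a (z 0) ω else 0

/-- State at the start of cycle `n` (cycles are numbered from `0`) on the arrival path `H`. -/
def stateAt {M T L : ℕ} [NeZero L] (a : Fulfillment) (S : ℕ) (z₀ : Fin L → ℕ)
    (H : ℕ → CyclePath M T) : ℕ → (Fin L → ℕ)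
  | 0 => z₀
  | n + 1 => nextState a S (stateAt a S z₀ H n) (H n)

/-- A path of `N` cycles, continued arbitrarily; only the first `N` cycles are ever used. -/
def extendPath {M T N : ℕ} (H : Fin N → CyclePath M T) (n : ℕ) : CyclePath M T :=
  if hn : n < N then H ⟨n, hn⟩ else fun _ => 0

/-- Expected average profit per cycle over `N` cycles under base-stock level `S`, from the
initial state `z₀`. -/
def avgProfit {M L : ℕ} [NeZero L] (a : Fulfillment) (lam r : Fin (M + 1) → ℝ) (h : ℝ)
    (T S : ℕ) (z₀ : Fin L → ℕ) (N : ℕ) : ℝ :=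
  (1 / (N : ℝ)) * ∑ H : Fin N → CyclePath M T, (∏ n, pathProb lam (H n)) *
    ∑ n : Fin N, cycleProfit a r h (stateAt a S z₀ (extendPath H) n 0) (H n)

/-- Long-run average profit per cycle. -/
def longRunProfit {M L : ℕ} [NeZero L] (a : Fulfillment) (lam r : Fin (M + 1) → ℝ) (h : ℝ)
    (T S : ℕ) (z₀ : Fin L → ℕ) : ℝ :=
  limUnder atTop (avgProfit a lam r h T S z₀)

/-- `S` maximizes the long-run average profit over all base-stock levels; `init S'` is the initial
state used with level `S'`. -/
def IsOptimalLevel {M L : ℕ} [NeZero L] (a : Fulfillment) (lam r : Fin (M + 1) → ℝ) (h : ℝ)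
    (T : ℕ) (init : ℕ → Fin L → ℕ) (S : ℕ) : Prop :=
  ∀ S' : ℕ, longRunProfit a lam r h T S' (init S') ≤ longRunProfit a lam r h T S (init S)

/-- One-cycle transition probability of the inventory state. -/
def transProb {M L : ℕ} [NeZero L] (a : Fulfillment) (lam : Fin (M + 1) → ℝ) (T S : ℕ)
    (z z' : Fin L → ℕ) : ℝ :=
  ∑ ω : CyclePath M T with nextState a S z ω = z', pathProb lam ω

/-- `ν` is the probability mass function of a stationary distribution of the inventory state. -/
structure IsStationaryLaw {M L : ℕ} [NeZero L] (a : Fulfillment) (lam : Fin (M + 1) → ℝ) (T S : ℕ)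
    (ν : (Fin L → ℕ) → ℝ) : Prop where
  nonneg : ∀ z, 0 ≤ ν z
  support : ∀ z, z ∉ feasibleStates L S → ν z = 0
  total : ∑ z ∈ feasibleStates L S, ν z = 1
  invariant : ∀ z', ∑ z ∈ feasibleStates L S, ν z * transProb a lam T S z z' = ν z'

/-- `E |I - S / (L + 1)|`, where `I` is the start-of-cycle on-hand inventory and the state has
probability mass function `ν`. -/
def meanAbsDev {L : ℕ} [NeZero L] (S : ℕ) (ν : (Fin L → ℕ) → ℝ) : ℝ :=
  ∑ z ∈ feasibleStates L S, ν z * |(z 0 : ℝ) - (S : ℝ) / ((L : ℝ) + 1)|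

/-- Slack `Δ = (L + 1) T (1 - λ₀) - S`. -/
def slack {M : ℕ} (L : ℕ) (lam : Fin (M + 1) → ℝ) (T S : ℕ) : ℝ :=
  ((L : ℝ) + 1) * T * (1 - lam 0) - S

/-- Interior regime `(L + 1) T λ_M < S < (L + 1) T (1 - λ₀)`. -/
def Interior {M : ℕ} (L : ℕ) (lam : Fin (M + 1) → ℝ) (T S : ℕ) : Prop :=
  ((L : ℝ) + 1) * T * lam (Fin.last M) < S ∧ (S : ℝ) < ((L : ℝ) + 1) * T * (1 - lam 0)

/-- `(r_M - r_1) (1 - λ₀ - λ₁) / (1 - λ₀) * (Δ / (L + 1) + (K₂ + √((1 - λ₀) λ₀)) √T)`. -/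
def gapBound {M : ℕ} (L : ℕ) (lam r : Fin (M + 1) → ℝ) (T S : ℕ) (K₂ : ℝ) : ℝ :=
  (r (Fin.last M) - r 1) * ((1 - lam 0 - lam 1) / (1 - lam 0)) *
    (slack L lam T S / ((L : ℝ) + 1) +
      (K₂ + Real.sqrt ((1 - lam 0) * lam 0)) * Real.sqrt T)

end BaseStock

end

open BaseStock

/-! The two algorithms sell the same number of units, the minimum of the stock `I` and the number
`D` of arrivals. They therefore move the inventory state identically and share their stationary
laws. Long-run profit is a stationary mean, and the greedy optimum is at least the greedy profit at
`Soff`. It thus suffices to compare both rewards at level `Soff` under one stationary law.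

Within a cycle, offline gains at most `r_M - r_1` for each customer of type other than 1 that greedy
loses (`offline_reward_sub_greedy_reward_le`). Greedy's stock in a period does not depend on the
type arriving in that period, so a lost customer has type other than 1 with probability `(1 - λ₀ -
λ₁) / (1 - λ₀)` (`expect_lost_type`). The mean number lost is `E (D - I)⁺`, which the triangle
inequality bounds by `E |D - T(1 - λ₀)|`, plus `Δ / (L + 1)`, plus `E |I - S / (L + 1)|`. These are
the three terms of `gapBound`.

Concentration of `I` rests on conservation: on-hand stock and the `L` outstanding orders sum to `S`,
and in stationarity each order is distributed as the sales of a cycle. As sales never exceed `D`,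
orders are rarely large; so `I` is rarely small, so sales are rarely small, so `I` is rarely large.
This gives `E |I - m| ≤ L (L + 2) E |D - m|` with `m = S / (L + 1)` (`meanAbsDev_le`).

The right side is `O(√T)` because optimality forces `Δ = O(√T)` (`IsOptimalLevel.slack_le`):
stationary sales are at most `S / (L + 1)`, so slack costs at least `r_1 Δ / (L + 1)`, whereas the
level `⌊(L + 1) T (1 - λ₀)⌋` loses only `O(√T)`. The same comparison shows that `λ₀ = 0` is
incompatible with the interior regime. Hence empty cycles have positive probability, and the
long-run profit equals the mean under every stationary law. -/

noncomputable section

namespace BaseStock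

/-! ### Ergodic averages of finite Markov chains -/

section

/-- Mean ergodic theorem for a contraction in finite dimension: the space splits into fixed vectors,
whose averages are constant, and coboundaries `P u - u`, whose averages telescope to 0. A vector of
both kinds must vanish, and rank-nullity shows that the two subspaces span. -/
theorem exists_tendsto_birkhoffAverage {E : Type*} [NormedAddCommGroup E] [NormedSpace ℝ E]
    [FiniteDimensional ℝ E] (P : E →ₗ[ℝ] E) (hP : ∀ x, ‖P x‖ ≤ ‖x‖) (x : E) :
    ∃ w, P w = w ∧ Tendsto (birkhoffAverage ℝ P _root_.id · x) atTop (𝓝 w) := by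
  have hbound : ∀ (n : ℕ) (u : E), ‖P^[n] u‖ ≤ ‖u‖ := by
    intro n u
    induction n with
    | zero => simp
    | succ n ih => rw [Function.iterate_succ_apply']; exact (hP _).trans ih
  have htend : ∀ u : E, Tendsto (birkhoffAverage ℝ P _root_.id · (P u - u)) atTop (𝓝 0) := by
    intro u
    have hb : Bornology.IsBounded (Set.range (_root_.id <| P^[·] u)) :=
      isBounded_iff_forall_norm_le.2 ⟨‖u‖, Set.forall_mem_range.2 fun n ↦ hbound n u⟩
    have H : ∀ n x y, P^[n] (x - y) = P^[n] x - P^[n] y := iterate_map_sub (P : E →+ E)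
    simpa [birkhoffAverage, birkhoffSum, Finset.sum_sub_distrib, smul_sub, H]
      using tendsto_birkhoffAverage_apply_sub_birkhoffAverage ℝ hb
  have hdisj : Disjoint (LinearMap.ker (P - 1)) (LinearMap.range (P - 1)) := by
    rw [Submodule.disjoint_def]
    rintro y hy ⟨u, rfl⟩
    have hfix : Function.IsFixedPt P ((P - 1) u) := by
      simpa [sub_eq_zero, Function.IsFixedPt] using hy
    exact tendsto_nhds_unique (hfix.tendsto_birkhoffAverage ℝ _root_.id) (htend u)
  have htop : LinearMap.ker (P - 1) ⊔ LinearMap.range (P - 1) = ⊤ := by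
    apply Submodule.eq_top_of_disjoint _ _ _ hdisj
    rw [add_comm]
    exact (LinearMap.finrank_range_add_finrank_ker (P - 1)).ge
  obtain ⟨w, hw, y, ⟨u, rfl⟩, rfl⟩ := Submodule.mem_sup.1 (htop.symm ▸ Submodule.mem_top : x ∈ _)
  have hw' : P w = w := by simpa [sub_eq_zero] using hw
  refine ⟨w, hw', ?_⟩
  have h1 := ((show Function.IsFixedPt P w from hw').tendsto_birkhoffAverage ℝ _root_.id).add
    (htend u)
  have H : ∀ n x y, P^[n] (x + y) = P^[n] x + P^[n] y := iterate_map_add (P : E →+ E)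
  simpa [birkhoffAverage, birkhoffSum, Finset.sum_add_distrib, smul_add, H] using h1

section Markov

variable {X Ω : Type*} [Fintype Ω]

/-- The Markov operator of the random iteration of `step` with i.i.d. noise of weights `p`. -/
def markovOp (p : Ω → ℝ) (step : X → Ω → X) : (X → ℝ) →ₗ[ℝ] (X → ℝ) where
  toFun f x := ∑ ω, p ω * f (step x ω)
  map_add' f g := by ext x; simp [mul_add, Finset.sum_add_distrib]
  map_smul' c f := by
    ext x; simp only [Pi.smul_apply, smul_eq_mul, RingHom.id_apply, Finset.mul_sum]
    exact Finset.sum_congr rfl fun _ _ => by ring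

theorem markovOp_apply (p : Ω → ℝ) (step : X → Ω → X) (f : X → ℝ) (x : X) :
    markovOp p step f x = ∑ ω, p ω * f (step x ω) := rfl

variable {p : Ω → ℝ} {step : X → Ω → X}

theorem norm_markovOp_le [Fintype X] (hp : ∀ ω, 0 ≤ p ω) (hp1 : ∑ ω, p ω = 1) (f : X → ℝ) :
    ‖markovOp p step f‖ ≤ ‖f‖ := by
  rw [pi_norm_le_iff_of_nonneg (norm_nonneg f)]
  intro x
  rw [markovOp_apply]
  calc ‖∑ ω, p ω * f (step x ω)‖ ≤ ∑ ω, ‖p ω * f (step x ω)‖ := norm_sum_le _ _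
    _ ≤ ∑ ω, p ω * ‖f‖ := by
      refine Finset.sum_le_sum fun ω _ => ?_
      rw [norm_mul, Real.norm_of_nonneg (hp ω)]
      exact mul_le_mul_of_nonneg_left (norm_le_pi_norm f _) (hp ω)
    _ = ‖f‖ := by rw [← Finset.sum_mul, hp1, one_mul]

theorem markovOp_const (hp1 : ∑ ω, p ω = 1) (c : ℝ) :
    markovOp p step (fun _ => c) = fun _ => c := by
  ext x; rw [markovOp_apply, ← Finset.sum_mul, hp1, one_mul]

theorem iterate_markovOp_nonneg (hp : ∀ ω, 0 ≤ p ω) {f : X → ℝ} (hf : ∀ x, 0 ≤ f x) (n : ℕ) :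
    ∀ x, 0 ≤ (markovOp p step)^[n] f x := by
  induction n with
  | zero => exact hf
  | succ n ih =>
    intro x
    rw [Function.iterate_succ_apply', markovOp_apply]
    exact Finset.sum_nonneg fun ω _ => mul_nonneg (hp ω) (ih _)

/-- A finite Markov chain started at `x₀` has a limiting occupation law, which is stationary and
computes the limits of all time averages. -/
theorem exists_limit_law [Fintype X] (hp : ∀ ω, 0 ≤ p ω) (hp1 : ∑ ω, p ω = 1) (x₀ : X) :
    ∃ ν : X → ℝ, (∀ x, 0 ≤ ν x) ∧ ∑ x, ν x = 1 ∧
      (∀ f, ∑ x, ν x * markovOp p step f x = ∑ x, ν x * f x) ∧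
      ∀ f, Tendsto (fun N => birkhoffAverage ℝ (markovOp p step) _root_.id N f x₀) atTop
        (𝓝 (∑ x, ν x * f x)) := by
  classical
  set P := markovOp p step
  have hP : ∀ f, ‖P f‖ ≤ ‖f‖ := norm_markovOp_le hp hp1
  choose w hw hlim using exists_tendsto_birkhoffAverage P hP
  have hlim0 : ∀ f, Tendsto (fun N => birkhoffAverage ℝ P _root_.id N f x₀) atTop
      (𝓝 (w f x₀)) := fun f => (tendsto_pi_nhds.1 (hlim f)) x₀
  have hexp : ∀ f : X → ℝ, f = ∑ x, f x • (Pi.single x 1 : X → ℝ) := by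
    intro f; ext y; simp [Finset.sum_apply, Pi.single_apply]
  -- The limit at `x₀` is a linear functional of `f`, so it is a weighted sum whose weights are its
  -- values on point masses; these weights form the law.
  have hlin : ∀ f, w f x₀ = ∑ x, w (Pi.single x 1) x₀ * f x := by
    intro f
    refine tendsto_nhds_unique (hlim0 f) ?_
    have := tendsto_finsetSum Finset.univ fun x (_ : x ∈ Finset.univ) =>
      (hlim0 (Pi.single x 1)).mul_const (f x)
    refine this.congr fun N => ?_
    have hit : ∀ k, P^[k] f = ∑ x, f x • P^[k] (Pi.single x 1 : X → ℝ) := by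
      intro k
      simp only [← Module.End.pow_apply]
      conv_lhs => rw [hexp f]
      simp only [map_sum, map_smul]
    simp only [birkhoffAverage, birkhoffSum, _root_.id, Pi.smul_apply, Finset.sum_apply,
      smul_eq_mul, hit, mul_assoc, ← Finset.mul_sum]
    congr 1
    simp only [Finset.sum_mul]
    rw [Finset.sum_comm]
    exact Finset.sum_congr rfl fun _ _ => Finset.sum_congr rfl fun _ _ => by ring
  have hinv : ∀ f, w (P f) x₀ = w f x₀ := by
    intro f
    have hb : Bornology.IsBounded (Set.range (_root_.id <| P^[·] f)) := by
      refine isBounded_iff_forall_norm_le.2 ⟨‖f‖, Set.forall_mem_range.2 fun n ↦ ?_⟩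
      induction n with
      | zero => simp
      | succ n ih =>
        simp only [_root_.id, Function.iterate_succ_apply'] at ih ⊢
        exact (hP _).trans ih
    have h0 := tendsto_birkhoffAverage_apply_sub_birkhoffAverage ℝ hb
    have h1 := (hlim (P f)).sub (hlim f)
    have h2 := tendsto_nhds_unique h0 h1
    exact (sub_eq_zero.1 (congrFun h2.symm x₀))
  refine ⟨fun x => w (Pi.single x 1) x₀, fun x => ?_, ?_, fun f => ?_, fun f => ?_⟩
  · refine ge_of_tendsto' (hlim0 _) fun N => ?_
    simp only [birkhoffAverage, birkhoffSum, _root_.id, Pi.smul_apply, Finset.sum_apply,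
      smul_eq_mul]
    refine mul_nonneg (by positivity) (Finset.sum_nonneg fun k _ => ?_)
    refine iterate_markovOp_nonneg hp (fun y => ?_) k x₀
    by_cases hy : y = x <;> simp [hy]
  · have h1 : P (fun _ => 1) = fun _ => 1 := markovOp_const hp1 1
    have h2 := (show Function.IsFixedPt P (fun _ => (1 : ℝ)) from h1).tendsto_birkhoffAverage ℝ
      _root_.id
    have h3 := congrFun (tendsto_nhds_unique h2 (hlim _)) x₀
    have h4 := hlin (fun _ => 1)
    simp only [_root_.id, mul_one] at h3 h4
    rw [← h4, ← h3]
  · rw [← hlin, ← hlin, hinv]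
  · rw [← hlin]; exact hlim0 f

/-- If some point is reached from everywhere along noise values of positive weight, functions
fixed by the Markov operator are constant. -/
theorem eq_of_markovOp_eq_self [Finite X] (hp : ∀ ω, 0 ≤ p ω) (hp1 : ∑ ω, p ω = 1) {ω₀ : Ω}
    (hω₀ : 0 < p ω₀) {s : X} {n : ℕ} (hs : ∀ x, (step · ω₀)^[n] x = s) {f : X → ℝ}
    (hf : markovOp p step f = f) (x : X) : f x = f s := by
  have key : ∀ g : X → ℝ, markovOp p step g = g → ∀ x, g x ≤ g s := by
    intro g hg x
    have : Nonempty X := ⟨x⟩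
    obtain ⟨y, hy⟩ := Finite.exists_max g
    -- Maximum principle: where `g` attains its maximum, `g` is an average of values that are no
    -- larger, so every successor of positive weight also attains it.
    have hstep : ∀ z, g z = g y → g (step z ω₀) = g y := by
      intro z hz
      have h0 : ∑ ω, p ω * (g y - g (step z ω)) = 0 := by
        have := congrFun hg z
        rw [markovOp_apply] at this
        simp only [mul_sub, Finset.sum_sub_distrib, this, ← Finset.sum_mul, hp1, hz]
        ring
      have h1 := (Finset.sum_eq_zero_iff_of_nonneg fun ω _ =>
        mul_nonneg (hp ω) (sub_nonneg.2 (hy _))).1 h0 ω₀ (Finset.mem_univ _)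
      rcases mul_eq_zero.1 h1 with h | h
      · exact absurd h hω₀.ne'
      · linarith
    have hit : ∀ k, g ((step · ω₀)^[k] y) = g y := by
      intro k
      induction k with
      | zero => rfl
      | succ k ih => rw [Function.iterate_succ_apply']; exact hstep _ ih
    rw [← hs y, hit n]
    exact hy x
  refine le_antisymm (key f hf x) ?_
  have := key (-f) (by rw [map_neg, hf]) x
  simpa using this

end Markov

end

/-! ### Sales and rewards within one cycle -/

section

/-- In a finite set that is strictly and totally ordered by `lt`, exactly `min I #U` elements have
fewer than `I` predecessors. -/
theorem card_filter_card_pred_lt {α : Type*} [DecidableEq α] (U : Finset α) (lt : α → α → Prop)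
    [DecidableRel lt] (hirr : ∀ a, ¬ lt a a) (htrans : ∀ a b c, lt a b → lt b c → lt a c)
    (htot : ∀ a b, a ≠ b → lt a b ∨ lt b a) (I : ℕ) :
    (U.filter fun t => (U.filter fun s => lt s t).card < I).card = min I U.card := by
  -- The rank is injective with values below `#U`, so it is a bijection onto `range #U`.
  set rk : α → ℕ := fun t => (U.filter fun s => lt s t).card with hrk
  have hmono : ∀ a ∈ U, ∀ b, lt a b → rk a < rk b := by
    intro a ha b hab
    apply Finset.card_lt_card
    rw [Finset.ssubset_iff_of_subset]
    · exact ⟨a, by simp [ha, hab], by simp [hirr]⟩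
    · intro s hs
      simp only [Finset.mem_filter] at hs ⊢
      exact ⟨hs.1, htrans _ _ _ hs.2 hab⟩
  have hinj : Set.InjOn rk U := by
    intro a ha b hb hab
    by_contra hne
    rcases htot a b hne with h | h
    · exact (hmono a ha b h).ne hab
    · exact (hmono b hb a h).ne' hab
  have hlt : ∀ a ∈ U, rk a < U.card := by
    intro a ha
    apply Finset.card_lt_card
    rw [Finset.ssubset_iff_of_subset (Finset.filter_subset _ _)]
    exact ⟨a, ha, by simp [hirr]⟩
  have himg : U.image rk = Finset.range U.card := by
    apply Finset.eq_of_subset_of_card_le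
    · intro k hk
      obtain ⟨a, ha, rfl⟩ := Finset.mem_image.1 hk
      exact Finset.mem_range.2 (hlt a ha)
    · rw [Finset.card_image_of_injOn hinj, Finset.card_range]
  have h2 : (U.filter fun t => rk t < I).image rk = Finset.range (min I U.card) := by
    ext k
    rw [Finset.mem_image, Finset.mem_range]
    constructor
    · rintro ⟨a, ha, rfl⟩
      rw [Finset.mem_filter] at ha
      exact lt_min ha.2 (hlt a ha.1)
    · intro hk
      have : k ∈ U.image rk := by
        rw [himg]; exact Finset.mem_range.2 (hk.trans_le (min_le_right _ _))
      obtain ⟨a, ha, rfl⟩ := Finset.mem_image.1 this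
      exact ⟨a, Finset.mem_filter.2 ⟨ha, hk.trans_le (min_le_left _ _)⟩, rfl⟩
  rw [← Finset.card_range (min I U.card), ← h2, Finset.card_image_of_injOn]
  exact hinj.mono fun a ha => (Finset.mem_filter.1 ha).1

variable {M T : ℕ}

/-- Periods in which a customer arrives. -/
def arrivals (ω : CyclePath M T) : Finset (Fin T) := Finset.univ.filter fun t => ω t ≠ 0

theorem mem_arrivals {ω : CyclePath M T} {t : Fin T} : t ∈ arrivals ω ↔ ω t ≠ 0 := by
  simp [arrivals]

/-- The service priority is a strict total order on the arriving customers; empty periods never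
precede a customer because 0 is the lowest type. -/
theorem card_offlineAccepted (I : ℕ) (ω : CyclePath M T) :
    (offlineAccepted I ω).card = min I (arrivals ω).card := by
  rw [← card_filter_card_pred_lt (arrivals ω) (fun s t => ω t < ω s ∨ (ω s = ω t ∧ s < t))
    (by simp) (by grind) (by grind) I]
  congr 1
  ext t
  simp only [offlineAccepted, arrivals, Finset.mem_filter, Finset.mem_univ, true_and,
    Finset.filter_filter]
  refine and_congr_right fun ht => ?_
  suffices h : (Finset.univ.filter fun s => ω t < ω s ∨ (ω s = ω t ∧ s < t)) =
      Finset.univ.filter fun s => ω s ≠ 0 ∧ (ω t < ω s ∨ (ω s = ω t ∧ s < t)) by rw [h]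
  refine Finset.filter_congr fun s _ => ⟨fun hs => ⟨?_, hs⟩, fun hs => hs.2⟩
  rcases hs with hs | hs
  · exact (Fin.pos_of_ne_zero ht |>.trans hs).ne'
  · rw [hs.1]; exact ht

/-- Greedy's stock depends only on the number of earlier arrivals. Truncated subtraction accounts
for customers who come after the stock has run out. -/
theorem greedyStock_eq (I : ℕ) (ω : CyclePath M T) (t : ℕ) :
    greedyStock I ω t = I - ((arrivals ω).filter fun s : Fin T => (s : ℕ) < t).card := by
  induction t with
  | zero => simp [greedyStock]
  | succ t ih =>
    rw [greedyStock]
    by_cases ht : t < T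
    · have hfil : ((arrivals ω).filter fun s : Fin T => (s : ℕ) < t + 1) =
          if ω ⟨t, ht⟩ ≠ 0 then insert ⟨t, ht⟩ ((arrivals ω).filter fun s : Fin T => (s : ℕ) < t)
          else (arrivals ω).filter fun s : Fin T => (s : ℕ) < t := by
        ext s
        by_cases h0 : ω ⟨t, ht⟩ = 0
        · simp only [Finset.mem_filter, mem_arrivals, h0, ne_eq, not_true, if_false]
          refine and_congr_right fun hs => ⟨fun h => ?_, fun h => by omega⟩
          rcases Nat.lt_succ_iff_lt_or_eq.1 h with h | h
          · exact h
          · exact absurd (by rw [show s = ⟨t, ht⟩ from Fin.ext h]; exact h0) hs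
        · simp only [ne_eq, h0, not_false_iff, if_true, Finset.mem_insert, Finset.mem_filter,
            mem_arrivals]
          constructor
          · rintro ⟨hs, h⟩
            rcases Nat.lt_succ_iff_lt_or_eq.1 h with h | h
            · exact Or.inr ⟨hs, h⟩
            · exact Or.inl (Fin.ext h)
          · rintro (rfl | ⟨hs, h⟩)
            · exact ⟨h0, Nat.lt_succ_self _⟩
            · exact ⟨hs, by omega⟩
      rw [hfil, ih, dif_pos ht]
      by_cases h0 : ω ⟨t, ht⟩ = 0
      · simp [h0]
      · rw [if_pos h0, Finset.card_insert_of_notMem (by simp)]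
        split_ifs with h
        · omega
        · have : ¬ 0 < I - ((arrivals ω).filter fun s : Fin T => (s : ℕ) < t).card := fun h' => h ⟨h0, h'⟩
          omega
    · rw [dif_neg ht, ih]
      congr 2
      refine Finset.filter_congr fun s _ => ?_
      have := s.2
      omega

theorem card_greedyAccepted (I : ℕ) (ω : CyclePath M T) :
    (greedyAccepted I ω).card = min I (arrivals ω).card := by
  rw [← card_filter_card_pred_lt (arrivals ω) (fun s t => s < t)
    (by simp) (by grind) (by grind) I]
  congr 1
  ext t
  simp only [greedyAccepted, greedyStock_eq, Finset.mem_filter, Finset.mem_univ, true_and,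
    mem_arrivals, Fin.lt_def, tsub_pos_iff_lt]

theorem card_accepted (a : Fulfillment) (I : ℕ) (ω : CyclePath M T) :
    (accepted a I ω).card = min I (arrivals ω).card := by
  cases a
  · exact card_offlineAccepted I ω
  · exact card_greedyAccepted I ω

theorem leftover_eq (a : Fulfillment) (I : ℕ) (ω : CyclePath M T) :
    leftover a I ω = I - (arrivals ω).card := by
  rw [leftover, card_accepted]; omega

theorem accepted_subset (a : Fulfillment) (I : ℕ) (ω : CyclePath M T) :
    accepted a I ω ⊆ arrivals ω := by
  intro t ht
  cases a <;> simp only [accepted, offlineAccepted, greedyAccepted, Finset.mem_filter] at ht <;>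
    exact mem_arrivals.2 ht.2.1

/-- Number of customers lost in a cycle with `I` units. -/
theorem card_arrivals_sdiff (a : Fulfillment) (I : ℕ) (ω : CyclePath M T) :
    (((arrivals ω) \ accepted a I ω).card : ℝ) = ((arrivals ω).card - I : ℕ) := by
  rw [Finset.card_sdiff_of_subset (accepted_subset a I ω), card_accepted]
  congr 1; omega

theorem one_le_of_ne_zero {j : Fin (M + 1)} (hj : j ≠ 0) : (1 : Fin (M + 1)) ≤ j := by
  rcases M with _ | M
  · exact absurd (Fin.fin_one_eq_zero j) hj
  · rw [Fin.le_def, Fin.val_one]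
    exact Nat.one_le_iff_ne_zero.2 fun h => hj (Fin.ext h)

/-- Reward obtained by offline over greedy, in terms of the customers lost by greedy. -/
theorem offline_reward_sub_greedy_reward_le {r : Fin (M + 1) → ℝ} (hr : StrictMono r) (I : ℕ)
    (ω : CyclePath M T) :
    ∑ t ∈ offlineAccepted I ω, r (ω t) - ∑ t ∈ greedyAccepted I ω, r (ω t) ≤
      (r (Fin.last M) - r 1) *
        ((arrivals ω \ greedyAccepted I ω).filter fun t => ω t ≠ 1).card := by
  set O := offlineAccepted I ω
  set G := greedyAccepted I ω
  have hO : O ⊆ arrivals ω := accepted_subset .offline I ω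
  have hG : G ⊆ arrivals ω := accepted_subset .greedy I ω
  -- Equal sales make the two differences equally large, so the contributions of the base reward `r
  -- 1` cancel.
  have hc : (O \ G).card = (G \ O).card := by
    have h1 : O.card = G.card := by
      rw [card_offlineAccepted, card_greedyAccepted]
    have h2 := Finset.card_sdiff_add_card_inter O G
    have h3 := Finset.card_sdiff_add_card_inter G O
    rw [Finset.inter_comm] at h3
    omega
  have hd : 0 ≤ r (Fin.last M) - r 1 := sub_nonneg.2 (hr.monotone (Fin.le_last _))
  have h1 : ∑ t ∈ O \ G, r (ω t) ≤
      ∑ t ∈ O \ G, (r 1 + (r (Fin.last M) - r 1) * if ω t ≠ 1 then 1 else 0) := by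
    refine Finset.sum_le_sum fun t _ => ?_
    by_cases h : ω t = 1
    · simp [h]
    · simp only [ne_eq, h, not_false_iff, if_true]
      linarith [hr.monotone (Fin.le_last (ω t))]
  have h2 : ∑ t ∈ G \ O, r 1 ≤ ∑ t ∈ G \ O, r (ω t) :=
    Finset.sum_le_sum fun t ht =>
      hr.monotone (one_le_of_ne_zero (mem_arrivals.1 (hG (Finset.mem_sdiff.1 ht).1)))
  have h3 : (((O \ G).filter fun t => ω t ≠ 1).card : ℝ) ≤
      ((arrivals ω \ G).filter fun t => ω t ≠ 1).card := by
    exact_mod_cast Finset.card_le_card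
      (Finset.filter_subset_filter _ (Finset.sdiff_subset_sdiff hO le_rfl))
  have h4 := mul_le_mul_of_nonneg_left h3 hd
  rw [← Finset.sum_sdiff_sub_sum_sdiff]
  rw [Finset.sum_add_distrib, ← Finset.mul_sum, Finset.sum_boole, Finset.sum_const,
    nsmul_eq_mul, hc] at h1
  rw [Finset.sum_const, nsmul_eq_mul] at h2
  linarith

theorem reward_le_of_lost {r : Fin (M + 1) → ℝ} (hr : StrictMono r) (a : Fulfillment)
    (I : ℕ) (ω : CyclePath M T) :
    ∑ t ∈ accepted a I ω, r (ω t) ≤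
      ∑ t ∈ arrivals ω, r (ω t) - r 1 * ((arrivals ω).card - I : ℕ) := by
  rw [← Finset.sum_sdiff (accepted_subset a I ω), ← card_arrivals_sdiff a I ω]
  have : ∑ t ∈ arrivals ω \ accepted a I ω, r 1 ≤ ∑ t ∈ arrivals ω \ accepted a I ω, r (ω t) :=
    Finset.sum_le_sum fun t ht =>
      hr.monotone (one_le_of_ne_zero (mem_arrivals.1 (Finset.mem_sdiff.1 ht).1))
  rw [Finset.sum_const, nsmul_eq_mul] at this
  linarith

theorem reward_ge_of_lost {r : Fin (M + 1) → ℝ} (hr : StrictMono r) (a : Fulfillment)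
    (I : ℕ) (ω : CyclePath M T) :
    ∑ t ∈ arrivals ω, r (ω t) - r (Fin.last M) * ((arrivals ω).card - I : ℕ) ≤
      ∑ t ∈ accepted a I ω, r (ω t) := by
  rw [← Finset.sum_sdiff (accepted_subset a I ω), ← card_arrivals_sdiff a I ω]
  have : ∑ t ∈ arrivals ω \ accepted a I ω, r (ω t) ≤
      ∑ t ∈ arrivals ω \ accepted a I ω, r (Fin.last M) :=
    Finset.sum_le_sum fun t _ => hr.monotone (Fin.le_last _)
  rw [Finset.sum_const, nsmul_eq_mul] at this
  linarith

end

/-! ### Expectations over the independent arrivals of one cycle -/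

section

variable {M T : ℕ} {lam : Fin (M + 1) → ℝ}

/-- Expectation over the arrivals of one cycle. -/
def expect (lam : Fin (M + 1) → ℝ) (F : CyclePath M T → ℝ) : ℝ := ∑ ω, pathProb lam ω * F ω

theorem pathProb_nonneg (hlam : ∀ j, 0 ≤ lam j) (ω : CyclePath M T) : 0 ≤ pathProb lam ω :=
  Finset.prod_nonneg fun _ _ => hlam _

theorem sum_pathProb (hlam1 : ∑ j, lam j = 1) : ∑ ω : CyclePath M T, pathProb lam ω = 1 := by
  simp only [pathProb]
  have := Finset.prod_univ_sum (fun _ : Fin T => (Finset.univ : Finset (Fin (M + 1))))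
    (fun _ j => lam j)
  simpa [hlam1] using this.symm

theorem expect_add (F G : CyclePath M T → ℝ) :
    expect lam (fun ω => F ω + G ω) = expect lam F + expect lam G := by
  simp [expect, mul_add, Finset.sum_add_distrib]

theorem expect_sub (F G : CyclePath M T → ℝ) :
    expect lam (fun ω => F ω - G ω) = expect lam F - expect lam G := by
  simp [expect, mul_sub, Finset.sum_sub_distrib]

theorem expect_const_mul (c : ℝ) (F : CyclePath M T → ℝ) :
    expect lam (fun ω => c * F ω) = c * expect lam F := by
  simp only [expect, Finset.mul_sum]
  exact Finset.sum_congr rfl fun _ _ => by ring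

theorem expect_sum {ι : Type*} (s : Finset ι) (F : ι → CyclePath M T → ℝ) :
    expect lam (fun ω => ∑ i ∈ s, F i ω) = ∑ i ∈ s, expect lam (F i) := by
  simp only [expect, Finset.mul_sum]
  exact Finset.sum_comm

theorem expect_const (hlam1 : ∑ j, lam j = 1) (c : ℝ) :
    expect lam (fun _ : CyclePath M T => c) = c := by
  rw [expect, ← Finset.sum_mul, sum_pathProb hlam1, one_mul]

theorem expect_mono (hlam : ∀ j, 0 ≤ lam j) {F G : CyclePath M T → ℝ} (h : ∀ ω, F ω ≤ G ω) :
    expect lam F ≤ expect lam G :=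
  Finset.sum_le_sum fun ω _ => mul_le_mul_of_nonneg_left (h ω) (pathProb_nonneg hlam ω)

/-- The arrival in period `t` is independent of everything that does not look at it. -/
theorem expect_mul_coord (hlam1 : ∑ j, lam j = 1) (t : Fin T) {G : CyclePath M T → ℝ}
    (hG : ∀ ω j, G (Function.update ω t j) = G ω) (φ : Fin (M + 1) → ℝ) :
    expect lam (fun ω => G ω * φ (ω t)) = expect lam G * ∑ j, lam j * φ j := by
  rcases T with _ | n
  · exact t.elim0
  -- The product weight is factored by splitting off coordinate `t`.
  have hsplit : ∀ F : CyclePath M (n + 1) → ℝ, expect lam F =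
      ∑ η : Fin n → Fin (M + 1), (∏ s, lam (η s)) * ∑ j, lam j * F (t.insertNth j η) := by
    intro F
    rw [expect, ← (Fin.insertNthEquiv (fun _ => Fin (M + 1)) t).sum_comp, Fintype.sum_prod_type,
      Finset.sum_comm]
    refine Finset.sum_congr rfl fun η _ => ?_
    rw [Finset.mul_sum]
    refine Finset.sum_congr rfl fun j _ => ?_
    change pathProb lam (t.insertNth j η) * F (t.insertNth j η) = _
    simp only [pathProb, Fin.prod_univ_succAbove _ t,
      Fin.insertNth_apply_same, Fin.insertNth_apply_succAbove]
    ring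
  have hG' : ∀ j η, G (t.insertNth j η) = G (t.insertNth (0 : Fin (M + 1)) η) := by
    intro j η
    rw [← hG (t.insertNth (0 : Fin (M + 1)) η) j]
    congr 1
    simp
  rw [hsplit, hsplit, Finset.sum_mul]
  refine Finset.sum_congr rfl fun η _ => ?_
  simp only [Fin.insertNth_apply_same, hG', ← Finset.sum_mul, hlam1, one_mul, mul_assoc]
  congr 1
  rw [Finset.mul_sum]
  exact Finset.sum_congr rfl fun _ _ => by ring

theorem expect_sum_mul_coord (hlam1 : ∑ j, lam j = 1) {G : Fin T → CyclePath M T → ℝ}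
    (hG : ∀ t ω j, G t (Function.update ω t j) = G t ω) (φ : Fin (M + 1) → ℝ) :
    expect lam (fun ω => ∑ t, G t ω * φ (ω t)) = (∑ t, expect lam (G t)) * ∑ j, lam j * φ j := by
  rw [expect_sum, Finset.sum_mul]
  exact Finset.sum_congr rfl fun t _ => expect_mul_coord hlam1 t (hG t) φ

theorem expect_coord (hlam1 : ∑ j, lam j = 1) (t : Fin T) (φ : Fin (M + 1) → ℝ) :
    expect lam (fun ω : CyclePath M T => φ (ω t)) = ∑ j, lam j * φ j := by
  have := expect_mul_coord hlam1 t (G := fun _ => 1) (fun _ _ => rfl) φ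
  simpa [expect_const hlam1] using this

theorem sum_mul_ite_ne_zero (hlam1 : ∑ j, lam j = 1) :
    (∑ j, lam j * if j ≠ 0 then 1 else 0) = 1 - lam 0 := by
  rw [Fin.sum_univ_succ] at hlam1
  rw [Fin.sum_univ_succ]
  simp only [ne_eq, not_true, if_false, Fin.succ_ne_zero, not_false_iff, if_true, mul_one]
  linarith

theorem sum_mul_ite_ne_zero_one (hM : 2 ≤ M) (hlam1 : ∑ j, lam j = 1) :
    (∑ j, lam j * if j ≠ 0 ∧ j ≠ 1 then 1 else 0) = 1 - lam 0 - lam 1 := by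
  obtain ⟨k, rfl⟩ := Nat.exists_eq_add_of_le' hM
  rw [Fin.sum_univ_succ, Fin.sum_univ_succ] at hlam1
  rw [Fin.sum_univ_succ, Fin.sum_univ_succ]
  have h : ∀ x : Fin (k + 1), x.succ.succ ≠ (1 : Fin (k + 2 + 1)) := by
    intro x hx
    have := congrArg Fin.val hx
    simp at this
  simp only [Fin.succ_zero_eq_one] at hlam1
  simp only [ne_eq, not_true, if_false, Fin.succ_ne_zero, not_false_iff, true_and, and_false,
    false_and, if_true, mul_one, mul_zero, h, Fin.succ_zero_eq_one]
  linarith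

/-- Greedy is non-anticipating: the stock at time `t` ignores the arrival in period `t`. This
supplies the independence used in `expect_lost_type`. -/
theorem greedyStock_update (I : ℕ) (ω : CyclePath M T) (t : Fin T) (j : Fin (M + 1)) :
    greedyStock I (Function.update ω t j) t = greedyStock I ω t := by
  rw [greedyStock_eq, greedyStock_eq]
  congr 2
  ext s
  simp only [Finset.mem_filter, mem_arrivals]
  refine and_congr_left fun hs => ?_
  rw [Function.update_of_ne (by rintro rfl; exact lt_irrefl _ hs)]

/-- Among the customers lost by greedy, the types are distributed as among all customers. -/
theorem expect_lost_type (hM : 2 ≤ M) (hlam1 : ∑ j, lam j = 1) (I : ℕ) :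
    (1 - lam 0) * expect lam (fun ω : CyclePath M T =>
        (((arrivals ω \ greedyAccepted I ω).filter fun t => ω t ≠ 1).card : ℝ)) =
      (1 - lam 0 - lam 1) * expect lam (fun ω : CyclePath M T =>
        (((arrivals ω).card - I : ℕ) : ℝ)) := by
  have hstock : ∀ (t : Fin T) (ω : CyclePath M T) (j : Fin (M + 1)),
      (if greedyStock I (Function.update ω t j) t = 0 then (1 : ℝ) else 0) =
        if greedyStock I ω t = 0 then 1 else 0 := by
    intro t ω j; rw [greedyStock_update]
  have h1 : ∀ ω : CyclePath M T,
      (((arrivals ω \ greedyAccepted I ω).filter fun t => ω t ≠ 1).card : ℝ) =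
        ∑ t : Fin T, (if greedyStock I ω t = 0 then 1 else 0) *
          (fun j : Fin (M + 1) => if j ≠ 0 ∧ j ≠ 1 then (1 : ℝ) else 0) (ω t) := by
    intro ω
    simp only [ite_zero_mul_ite_zero, mul_one]
    rw [Finset.sum_boole]
    congr 2
    ext t
    simp only [Finset.mem_filter, Finset.mem_sdiff, mem_arrivals, greedyAccepted,
      Finset.mem_univ, true_and]
    grind
  have h2 : ∀ ω : CyclePath M T, (((arrivals ω).card - I : ℕ) : ℝ) =
        ∑ t : Fin T, (if greedyStock I ω t = 0 then 1 else 0) *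
          (fun j : Fin (M + 1) => if j ≠ 0 then (1 : ℝ) else 0) (ω t) := by
    intro ω
    rw [← card_arrivals_sdiff .greedy I ω]
    simp only [ite_zero_mul_ite_zero, mul_one]
    rw [Finset.sum_boole]
    congr 2
    ext t
    simp only [Finset.mem_filter, Finset.mem_sdiff, mem_arrivals, greedyAccepted,
      Finset.mem_univ, true_and, accepted]
    grind
  rw [funext h1, funext h2,
    expect_sum_mul_coord hlam1 hstock fun j => if j ≠ 0 ∧ j ≠ 1 then (1 : ℝ) else 0,
    expect_sum_mul_coord hlam1 hstock fun j => if j ≠ 0 then (1 : ℝ) else 0,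
    sum_mul_ite_ne_zero hlam1, sum_mul_ite_ne_zero_one hM hlam1]
  ring

theorem expect_card_arrivals (hlam1 : ∑ j, lam j = 1) :
    expect lam (fun ω : CyclePath M T => ((arrivals ω).card : ℝ)) = T * (1 - lam 0) := by
  have h : ∀ ω : CyclePath M T, ((arrivals ω).card : ℝ) =
      ∑ t, 1 * (fun j : Fin (M + 1) => if j ≠ 0 then (1 : ℝ) else 0) (ω t) := by
    intro ω; simp only [one_mul]; rw [Finset.sum_boole, arrivals]
  rw [funext h, expect_sum_mul_coord hlam1 (G := fun _ _ => 1) (fun _ _ _ => rfl)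
    (fun j => if j ≠ 0 then (1 : ℝ) else 0), sum_mul_ite_ne_zero hlam1]
  simp [expect_const hlam1]

theorem expect_sq_card_arrivals_sub (hlam1 : ∑ j, lam j = 1) :
    expect lam (fun ω : CyclePath M T => (((arrivals ω).card : ℝ) - T * (1 - lam 0)) ^ 2) =
      T * ((1 - lam 0) * lam 0) := by
  set φ : Fin (M + 1) → ℝ := fun j => (if j ≠ 0 then (1 : ℝ) else 0) - (1 - lam 0) with hφ
  have hφ0 : ∑ j, lam j * φ j = 0 := by
    simp only [hφ, mul_sub, Finset.sum_sub_distrib, ← Finset.sum_mul, hlam1]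
    rw [sum_mul_ite_ne_zero hlam1]; ring
  have hφ2 : ∑ j, lam j * φ j ^ 2 = (1 - lam 0) * lam 0 := by
    -- The square of a centred indicator is affine in the indicator.
    have : ∀ j, lam j * φ j ^ 2 = (2 * lam 0 - 1) * (lam j * if j ≠ 0 then 1 else 0) +
        (1 - lam 0) ^ 2 * lam j := by
      intro j
      simp only [hφ]
      split_ifs <;> ring
    simp only [this, Finset.sum_add_distrib, ← Finset.mul_sum, hlam1]
    rw [sum_mul_ite_ne_zero hlam1]; ring
  have h : ∀ ω : CyclePath M T, (((arrivals ω).card : ℝ) - T * (1 - lam 0)) ^ 2 =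
      ∑ t, ∑ s, φ (ω s) * φ (ω t) := by
    intro ω
    have : ((arrivals ω).card : ℝ) - T * (1 - lam 0) = ∑ t, φ (ω t) := by
      simp only [hφ, Finset.sum_sub_distrib]
      rw [Finset.sum_boole, arrivals]; simp [mul_sub]
    rw [this, sq, Finset.sum_mul_sum, Finset.sum_comm]
  simp only [h, expect_sum]
  -- Distinct periods are independent and centred, so only the diagonal contributes to the variance.
  have h2 : ∀ t s : Fin T, expect lam (fun ω : CyclePath M T => φ (ω s) * φ (ω t)) =
      if s = t then (1 - lam 0) * lam 0 else 0 := by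
    intro t s
    split_ifs with hst
    · subst hst
      rw [← hφ2, ← expect_coord hlam1 s (fun j => φ j ^ 2)]
      simp only [sq]
    · rw [expect_mul_coord hlam1 t (G := fun ω => φ (ω s)), hφ0, mul_zero]
      intro ω j
      rw [Function.update_of_ne hst]
  simp [h2]

theorem expect_abs_card_arrivals_sub_le (hlam : ∀ j, 0 ≤ lam j) (hlam1 : ∑ j, lam j = 1) :
    expect lam (fun ω : CyclePath M T => |((arrivals ω).card : ℝ) - T * (1 - lam 0)|) ≤
      Real.sqrt ((1 - lam 0) * lam 0) * Real.sqrt T := by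
  set c := expect lam (fun ω : CyclePath M T => |((arrivals ω).card : ℝ) - T * (1 - lam 0)|)
    with hc
  rw [mul_comm, ← Real.sqrt_mul (Nat.cast_nonneg T), ← expect_sq_card_arrivals_sub hlam1]
  apply Real.le_sqrt_of_sq_le
  -- Nonnegativity of the variance of `|D - T(1 - λ₀)|` bounds the squared first moment by the
  -- second moment.
  have h0 : 0 ≤ expect lam (fun ω : CyclePath M T =>
      (|((arrivals ω).card : ℝ) - T * (1 - lam 0)| - c) ^ 2) := by
    rw [← expect_const (T := T) hlam1 0]
    exact expect_mono hlam fun ω => sq_nonneg _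
  have h1 : ∀ ω : CyclePath M T, (|((arrivals ω).card : ℝ) - T * (1 - lam 0)| - c) ^ 2 =
      (((arrivals ω).card : ℝ) - T * (1 - lam 0)) ^ 2 -
        (2 * c) * |((arrivals ω).card : ℝ) - T * (1 - lam 0)| + c ^ 2 := by
    intro ω
    rw [← sq_abs ((arrivals ω).card - T * (1 - lam 0) : ℝ)]; ring
  simp only [h1, expect_add, expect_sub, expect_const_mul, expect_const hlam1, ← hc] at h0
  linarith

end

/-! ### The order pipeline and concentration of the stationary inventory -/

section

variable {M L T S : ℕ} {lam : Fin (M + 1) → ℝ}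

/-- On-hand inventory and outstanding orders after the order of the cycle has been placed. -/
def pipeline (S : ℕ) (z : Fin L → ℕ) : Fin (L + 1) → ℕ := Fin.snoc (α := fun _ => ℕ) z (orderQty S z)

theorem mem_feasibleStates {z : Fin L → ℕ} : z ∈ feasibleStates L S ↔ ∑ i, z i ≤ S := by
  simp only [feasibleStates, Finset.mem_filter, Fintype.mem_piFinset, Finset.mem_range,
    and_iff_right_iff_imp]
  intro h i
  exact Nat.lt_succ_of_le ((Finset.single_le_sum (f := z) (fun _ _ => Nat.zero_le _)
    (Finset.mem_univ i)).trans h)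

theorem pipeline_castSucc (z : Fin L → ℕ) (i : Fin L) : pipeline S z i.castSucc = z i := by
  simp [pipeline]

theorem pipeline_last (z : Fin L → ℕ) : pipeline S z (Fin.last L) = orderQty S z := by
  simp [pipeline]

theorem sum_pipeline {z : Fin L → ℕ} (hz : z ∈ feasibleStates L S) : ∑ i, pipeline S z i = S := by
  rw [Fin.sum_univ_castSucc]
  simp only [pipeline_castSucc, pipeline_last, orderQty]
  have := mem_feasibleStates.1 hz
  omega

/-- Expectation under the law `ν` of the inventory state. -/
def stateExpect (S : ℕ) (ν : (Fin L → ℕ) → ℝ) (F : (Fin L → ℕ) → ℝ) : ℝ :=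
  ∑ z ∈ feasibleStates L S, ν z * F z

variable {ν : (Fin L → ℕ) → ℝ}

theorem stateExpect_add (F G : (Fin L → ℕ) → ℝ) :
    stateExpect S ν (fun z => F z + G z) = stateExpect S ν F + stateExpect S ν G := by
  simp [stateExpect, mul_add, Finset.sum_add_distrib]

theorem stateExpect_sub (F G : (Fin L → ℕ) → ℝ) :
    stateExpect S ν (fun z => F z - G z) = stateExpect S ν F - stateExpect S ν G := by
  simp [stateExpect, mul_sub, Finset.sum_sub_distrib]

theorem stateExpect_const_mul (c : ℝ) (F : (Fin L → ℕ) → ℝ) :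
    stateExpect S ν (fun z => c * F z) = c * stateExpect S ν F := by
  simp only [stateExpect, Finset.mul_sum]
  exact Finset.sum_congr rfl fun _ _ => by ring

theorem stateExpect_sum {ι : Type*} (s : Finset ι) (F : ι → (Fin L → ℕ) → ℝ) :
    stateExpect S ν (fun z => ∑ i ∈ s, F i z) = ∑ i ∈ s, stateExpect S ν (F i) := by
  simp only [stateExpect, Finset.mul_sum]
  exact Finset.sum_comm

theorem stateExpect_congr {F G : (Fin L → ℕ) → ℝ} (h : ∀ z ∈ feasibleStates L S, F z = G z) :
    stateExpect S ν F = stateExpect S ν G :=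
  Finset.sum_congr rfl fun z hz => by rw [h z hz]

variable [NeZero L]

theorem pipeline_zero (z : Fin L → ℕ) : pipeline S z 0 = z 0 := by
  rw [← Fin.castSucc_zero', pipeline_castSucc]

theorem sum_pipeline_succ {z : Fin L → ℕ} (hz : z ∈ feasibleStates L S) :
    z 0 + ∑ i : Fin L, pipeline S z i.succ = S := by
  conv_rhs => rw [← sum_pipeline hz, Fin.sum_univ_succ, pipeline_zero]

theorem nextState_apply (a : Fulfillment) (z : Fin L → ℕ) (ω : CyclePath M T) (i : Fin L) :
    nextState a S z ω i = pipeline S z i.succ + if i = 0 then z 0 - (arrivals ω).card else 0 := by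
  rw [nextState, leftover_eq, pipeline]

theorem sum_nextState (a : Fulfillment) {z : Fin L → ℕ} (hz : z ∈ feasibleStates L S)
    (ω : CyclePath M T) :
    ∑ i, nextState a S z ω i + min (z 0) (arrivals ω).card = S := by
  have h := sum_pipeline_succ hz
  simp only [nextState_apply, Finset.sum_add_distrib, Finset.sum_ite_eq', Finset.mem_univ, if_true]
  omega

theorem nextState_mem (a : Fulfillment) {z : Fin L → ℕ} (hz : z ∈ feasibleStates L S)
    (ω : CyclePath M T) : nextState a S z ω ∈ feasibleStates L S :=
  mem_feasibleStates.2 (by have := sum_nextState a hz ω; omega)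

/-- Once the inventory position has been raised to `S`, only sales lower it, so each new order
replaces exactly the sales of the previous cycle. -/
theorem pipeline_nextState_last (a : Fulfillment) {z : Fin L → ℕ} (hz : z ∈ feasibleStates L S)
    (ω : CyclePath M T) :
    pipeline S (nextState a S z ω) (Fin.last L) = min (z 0) (arrivals ω).card := by
  rw [pipeline_last, orderQty]
  have := sum_nextState a hz ω
  omega

theorem pipeline_nextState_castSucc (a : Fulfillment) (z : Fin L → ℕ) (ω : CyclePath M T)
    {i : Fin L} (hi : i ≠ 0) :
    pipeline S (nextState a S z ω) i.castSucc = pipeline S z i.succ := by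
  rw [pipeline_castSucc, nextState_apply, if_neg hi, add_zero]

/-- Both algorithms move the inventory state in the same way. -/
theorem nextState_eq (a a' : Fulfillment) (z : Fin L → ℕ) (ω : CyclePath M T) :
    nextState a S z ω = nextState a' S z ω := by
  ext i; rw [nextState_apply, nextState_apply]

theorem IsStationaryLaw.of_fulfillment {a : Fulfillment} (a' : Fulfillment)
    (hν : IsStationaryLaw a lam T S ν) : IsStationaryLaw a' lam T S ν := by
  refine ⟨hν.nonneg, hν.support, hν.total, fun z' => ?_⟩
  rw [← hν.invariant z']
  simp only [transProb, nextState_eq a' a]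

variable {a : Fulfillment}

theorem stateExpect_mono (hν : IsStationaryLaw a lam T S ν)
    {F G : (Fin L → ℕ) → ℝ} (h : ∀ z ∈ feasibleStates L S, F z ≤ G z) :
    stateExpect S ν F ≤ stateExpect S ν G :=
  Finset.sum_le_sum fun z hz => mul_le_mul_of_nonneg_left (h z hz) (hν.nonneg z)

theorem stateExpect_const (hν : IsStationaryLaw a lam T S ν)
    (c : ℝ) : stateExpect S ν (fun _ => c) = c := by
  rw [stateExpect, ← Finset.sum_mul, hν.total, one_mul]

/-- Invariance tested against functions: grouping arrival paths by their successor state recovers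
the transition probabilities. -/
theorem stateExpect_nextState (hν : IsStationaryLaw a lam T S ν)
    (F : (Fin L → ℕ) → ℝ) :
    stateExpect S ν (fun z => expect lam fun ω : CyclePath M T => F (nextState a S z ω)) =
      stateExpect S ν F := by
  have h1 : ∀ z ∈ feasibleStates L S,
      expect lam (fun ω : CyclePath M T => F (nextState a S z ω)) =
        ∑ z' ∈ feasibleStates L S, transProb a lam T S z z' * F z' := by
    intro z hz
    rw [expect, ← Finset.sum_fiberwise_of_maps_to (g := fun ω => nextState a S z ω)
      fun ω _ => nextState_mem a hz ω]
    refine Finset.sum_congr rfl fun z' _ => ?_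
    rw [transProb, Finset.sum_mul]
    refine Finset.sum_congr rfl fun ω hω => ?_
    rw [(Finset.mem_filter.1 hω).2]
  rw [stateExpect_congr h1]
  simp only [stateExpect, Finset.mul_sum]
  rw [Finset.sum_comm]
  refine Finset.sum_congr rfl fun z' _ => ?_
  rw [← hν.invariant z', Finset.sum_mul]
  exact Finset.sum_congr rfl fun _ _ => by ring

/-- In the stationary regime every outstanding order is distributed as the sales of a cycle. -/
theorem stateExpect_pipeline (hν : IsStationaryLaw a lam T S ν)
    (hlam1 : ∑ j, lam j = 1) (f : ℕ → ℝ) (i : Fin L) :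
    stateExpect S ν (fun z => f (pipeline S z i.succ)) =
      stateExpect S ν fun z => expect lam fun ω : CyclePath M T =>
        f (min (z 0) (arrivals ω).card) := by
  suffices h : ∀ i : Fin (L + 1), i ≠ 0 → stateExpect S ν (fun z => f (pipeline S z i)) =
      stateExpect S ν fun z => expect lam fun ω : CyclePath M T =>
        f (min (z 0) (arrivals ω).card) from h i.succ (Fin.succ_ne_zero i)
  intro i
  -- The newest order equals the sales of the preceding cycle; any other order was one place further
  -- back a cycle earlier, and stationarity removes the shift.
  induction i using Fin.reverseInduction with
  | last =>
    intro _
    rw [← stateExpect_nextState hν]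
    refine stateExpect_congr fun z hz => ?_
    simp only [pipeline_nextState_last a hz]
  | cast j ih =>
    intro hj
    have hj' : j ≠ 0 := fun h => hj (by rw [h, Fin.castSucc_zero'])
    rw [← ih (Fin.succ_ne_zero j), ← stateExpect_nextState hν]
    refine stateExpect_congr fun z hz => ?_
    simp only [pipeline_nextState_castSucc a z _ hj']
    rw [expect_const hlam1]

/-- Stationary sales per cycle are at most `S / (L + 1)`. -/
theorem stationary_sales_le (hν : IsStationaryLaw a lam T S ν)
    (hlam : ∀ j, 0 ≤ lam j) (hlam1 : ∑ j, lam j = 1) :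
    stateExpect S ν (fun z => expect lam fun ω : CyclePath M T =>
      ((min (z 0) (arrivals ω).card : ℕ) : ℝ)) ≤ (S : ℝ) / ((L : ℝ) + 1) := by
  set d := stateExpect S ν (fun z => expect lam fun ω : CyclePath M T =>
      ((min (z 0) (arrivals ω).card : ℕ) : ℝ)) with hd
  -- Mean sales `d` are at most the mean on-hand stock, and each of the `L` orders has mean `d`;
  -- since all of these sum to `S`, `(L + 1) d ≤ S`.
  have h1 : d ≤ stateExpect S ν (fun z => (z 0 : ℝ)) := by
    refine stateExpect_mono hν fun z _ => ?_
    rw [← expect_const (T := T) hlam1 (z 0 : ℝ)]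
    exact expect_mono hlam fun ω => by exact_mod_cast min_le_left _ _
  have h2 : stateExpect S ν (fun z => (z 0 : ℝ)) +
      ∑ i : Fin L, stateExpect S ν (fun z => (pipeline S z i.succ : ℝ)) = S := by
    rw [← stateExpect_sum, ← stateExpect_add, ← stateExpect_const hν (S : ℝ)]
    refine stateExpect_congr fun z hz => ?_
    exact_mod_cast sum_pipeline_succ hz
  simp only [stateExpect_pipeline hν hlam1 (fun k => (k : ℝ)), ← hd, Finset.sum_const,
    Finset.card_univ, Fintype.card_fin, nsmul_eq_mul] at h2
  rw [le_div_iff₀ (by positivity)]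
  linarith

/-- Concentration of the stationary on-hand inventory around `S / (L + 1)`. -/
theorem meanAbsDev_le (hν : IsStationaryLaw a lam T S ν)
    (hlam : ∀ j, 0 ≤ lam j) (hlam1 : ∑ j, lam j = 1) :
    meanAbsDev S ν ≤ L * (L + 2) * expect lam (fun ω : CyclePath M T =>
      |((arrivals ω).card : ℝ) - (S : ℝ) / ((L : ℝ) + 1)|) := by
  set m : ℝ := (S : ℝ) / ((L : ℝ) + 1) with hm
  set b := expect lam (fun ω : CyclePath M T => |((arrivals ω).card : ℝ) - m|) with hb
  have hsum : ∀ z ∈ feasibleStates L S,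
      m - (z 0 : ℝ) = ∑ i : Fin L, ((pipeline S z i.succ : ℝ) - m) := by
    intro z hz
    have h1 : (z 0 : ℝ) + ∑ i : Fin L, (pipeline S z i.succ : ℝ) = S := by
      exact_mod_cast sum_pipeline_succ hz
    have h2 : (S : ℝ) = (L + 1) * m := by rw [hm]; field_simp
    rw [Finset.sum_sub_distrib]
    simp only [Finset.sum_const, Finset.card_univ, Fintype.card_fin, nsmul_eq_mul]
    linarith
  -- Orders are distributed as sales, which never exceed demand, so their excess over `m` is
  -- controlled by demand alone.
  have hpos : ∀ i : Fin L,
      stateExpect S ν (fun z => max ((pipeline S z i.succ : ℝ) - m) 0) ≤ b := by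
    intro i
    rw [stateExpect_pipeline hν hlam1 (fun k => max ((k : ℝ) - m) 0), ← stateExpect_const hν b]
    refine stateExpect_mono hν fun z _ => expect_mono hlam fun ω => max_le ?_ (abs_nonneg _)
    refine le_trans ?_ (le_abs_self _)
    have : ((min (z 0) (arrivals ω).card : ℕ) : ℝ) ≤ (arrivals ω).card := by
      exact_mod_cast min_le_right _ _
    linarith
  -- A deficit of on-hand stock must be matched by excesses of the orders, since the total is fixed.
  have hneg0 : stateExpect S ν (fun z => max (m - (z 0 : ℝ)) 0) ≤ L * b := by
    calc _ ≤ stateExpect S ν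
          (fun z => ∑ i : Fin L, max ((pipeline S z i.succ : ℝ) - m) 0) := by
          refine stateExpect_mono hν fun z hz => max_le ?_ ?_
          · rw [hsum z hz]
            exact Finset.sum_le_sum fun i _ => le_max_left _ _
          · exact Finset.sum_nonneg fun i _ => le_max_right _ _
      _ ≤ ∑ _i : Fin L, b := by
          rw [stateExpect_sum]
          exact Finset.sum_le_sum fun i _ => hpos i
      _ = L * b := by simp
  -- Low sales come from low stock, at a cost of `L * b`, or from low demand, at a cost of `b`.
  have hneg : ∀ i : Fin L,
      stateExpect S ν (fun z => max (m - (pipeline S z i.succ : ℝ)) 0) ≤ (L + 1) * b := by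
    intro i
    rw [stateExpect_pipeline hν hlam1 (fun k => max (m - (k : ℝ)) 0)]
    calc _ ≤ stateExpect S ν (fun z => max (m - (z 0 : ℝ)) 0 + b) := by
          refine stateExpect_mono hν fun z _ => ?_
          rw [hb, ← expect_const (T := T) hlam1 (max (m - (z 0 : ℝ)) 0), ← expect_add]
          refine expect_mono hlam fun ω => ?_
          rw [Nat.cast_min]
          have h1 := neg_abs_le (((arrivals ω).card : ℝ) - m)
          have h2 := abs_nonneg (((arrivals ω).card : ℝ) - m)
          have h3 := le_max_left (m - (z 0 : ℝ)) 0
          have h4 := le_max_right (m - (z 0 : ℝ)) 0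
          refine max_le ?_ (by linarith)
          rcases min_choice (z 0 : ℝ) ((arrivals ω).card : ℝ) with h | h <;> rw [h] <;> linarith
      _ ≤ (L + 1) * b := by
          rw [stateExpect_add, stateExpect_const hν]; linarith
  calc meanAbsDev S ν = stateExpect S ν (fun z => |(z 0 : ℝ) - m|) := rfl
    _ ≤ stateExpect S ν (fun z => ∑ i : Fin L, (max ((pipeline S z i.succ : ℝ) - m) 0 +
          max (m - (pipeline S z i.succ : ℝ)) 0)) := by
        refine stateExpect_mono hν fun z hz => ?_
        rw [abs_sub_comm, hsum z hz]
        refine (Finset.abs_sum_le_sum_abs _ _).trans (Finset.sum_le_sum fun i _ => ?_)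
        refine abs_le'.2 ⟨?_, ?_⟩
        · linarith [le_max_left ((pipeline S z i.succ : ℝ) - m) 0,
            le_max_right (m - (pipeline S z i.succ : ℝ)) 0]
        · linarith [le_max_right ((pipeline S z i.succ : ℝ) - m) 0,
            le_max_left (m - (pipeline S z i.succ : ℝ)) 0]
    _ ≤ ∑ _i : Fin L, (b + (L + 1) * b) := by
        rw [stateExpect_sum]
        refine Finset.sum_le_sum fun i _ => ?_
        rw [stateExpect_add]
        exact add_le_add (hpos i) (hneg i)
    _ = L * (L + 2) * b := by
        rw [Finset.sum_const, Finset.card_univ, Fintype.card_fin, nsmul_eq_mul]; ring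

end

/-! ### Long-run averages as stationary means -/

section

/-- If the functions fixed by the Markov operator are constant, then all time averages converge to
the mean under any stationary law. -/
theorem tendsto_birkhoffAverage_of_stationary {X Ω : Type*} [Fintype Ω] [Fintype X] {p : Ω → ℝ}
    {step : X → Ω → X} (hp : ∀ ω, 0 ≤ p ω) (hp1 : ∑ ω, p ω = 1)
    {s : X} (hconst : ∀ f, markovOp p step f = f → ∀ x, f x = f s)
    {ν : X → ℝ} (hν1 : ∑ x, ν x = 1)
    (hν : ∀ f, ∑ x, ν x * markovOp p step f x = ∑ x, ν x * f x) (f : X → ℝ) (x₀ : X) :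
    Tendsto (fun N => birkhoffAverage ℝ (markovOp p step) _root_.id N f x₀) atTop
      (𝓝 (∑ x, ν x * f x)) := by
  obtain ⟨w, hw, hlim⟩ := exists_tendsto_birkhoffAverage (markovOp p step)
    (norm_markovOp_le hp hp1) f
  have hpt := tendsto_pi_nhds.1 hlim
  -- Every time average has the same `ν`-mean as `f`; the limit is a fixed function, hence constant,
  -- so it equals this mean.
  have hit : ∀ n, ∑ x, ν x * (markovOp p step)^[n] f x = ∑ x, ν x * f x := by
    intro n
    induction n with
    | zero => rfl
    | succ n ih => rw [← ih]; simp only [Function.iterate_succ_apply', hν]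
  have h1 : Tendsto (fun N => ∑ x, ν x * birkhoffAverage ℝ (markovOp p step) _root_.id N f x) atTop
      (𝓝 (∑ x, ν x * w x)) :=
    tendsto_finsetSum _ fun x _ => (hpt x).const_mul (ν x)
  have h2 : Tendsto (fun N => ∑ x, ν x * birkhoffAverage ℝ (markovOp p step) _root_.id N f x) atTop
      (𝓝 (∑ x, ν x * f x)) := by
    refine tendsto_const_nhds.congr' ?_
    filter_upwards [eventually_ne_atTop 0] with N hN
    have hN' : (N : ℝ) ≠ 0 := Nat.cast_ne_zero.2 hN
    simp only [birkhoffAverage, birkhoffSum, _root_.id, Pi.smul_apply, Finset.sum_apply,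
      smul_eq_mul]
    simp only [Finset.mul_sum, mul_left_comm (ν _) (N : ℝ)⁻¹]
    rw [Finset.sum_comm]
    simp only [← Finset.mul_sum, hit, Finset.sum_const, Finset.card_range, nsmul_eq_mul]
    field_simp
  have h3 : ∑ x, ν x * w x = w s := by
    simp only [hconst w hw, ← Finset.sum_mul, hν1, one_mul]
  rw [tendsto_nhds_unique h2 h1, h3, ← hconst w hw x₀]
  exact hpt x₀

variable {M L T S : ℕ} {lam : Fin (M + 1) → ℝ}

theorem sum_feasibleStates (F : (Fin L → ℕ) → ℝ) :
    ∑ z ∈ feasibleStates L S, F z = ∑ x : feasibleStates L S, F x :=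
  (Finset.sum_coe_sort _ F).symm

variable [NeZero L]

/-- One cycle of the inventory process on the feasible states. -/
def feasibleStep (M T : ℕ) (a : Fulfillment) (x : feasibleStates L S) (ω : CyclePath M T) :
    feasibleStates L S :=
  ⟨nextState a S x ω, nextState_mem a x.2 ω⟩

/-- Expected profit of a cycle that starts in state `z`. -/
def expectedProfit (a : Fulfillment) (lam r : Fin (M + 1) → ℝ) (h : ℝ) (T : ℕ) (z : Fin L → ℕ) :
    ℝ :=
  expect lam fun ω : CyclePath M T => cycleProfit a r h (z 0) ω

theorem stateAt_succ' (a : Fulfillment) (z : Fin L → ℕ) (H : ℕ → CyclePath M T) (n : ℕ) :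
    stateAt a S z H (n + 1) = stateAt a S (nextState a S z (H 0)) (fun k => H (k + 1)) n := by
  induction n with
  | zero => rfl
  | succ n ih => rw [stateAt, ih]; rfl

theorem sum_prod_pathProb (hlam1 : ∑ j, lam j = 1) (N : ℕ) :
    ∑ H : Fin N → CyclePath M T, ∏ n, pathProb lam (H n) = 1 := by
  have := Finset.prod_univ_sum (fun _ : Fin N => (Finset.univ : Finset (CyclePath M T)))
    (fun _ ω => pathProb lam ω)
  simpa [sum_pathProb hlam1] using this.symm

theorem extendPath_cons_zero {N : ℕ} (ω : CyclePath M T) (H : Fin N → CyclePath M T) :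
    extendPath (Fin.cons ω H : Fin (N + 1) → CyclePath M T) 0 = ω := by
  simp [extendPath]

theorem extendPath_cons_succ {N : ℕ} (ω : CyclePath M T) (H : Fin N → CyclePath M T) (k : ℕ) :
    extendPath (Fin.cons ω H : Fin (N + 1) → CyclePath M T) (k + 1) = extendPath H k := by
  by_cases hk : k < N
  · have : (⟨k + 1, Nat.succ_lt_succ hk⟩ : Fin (N + 1)) = Fin.succ ⟨k, hk⟩ := rfl
    rw [extendPath, extendPath, dif_pos hk, dif_pos (Nat.succ_lt_succ hk), this, Fin.cons_succ]
  · rw [extendPath, extendPath, dif_neg hk, dif_neg (by omega)]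

theorem sum_eq_sum_cons {α : Type*} [Fintype α] {N : ℕ} (F : (Fin (N + 1) → α) → ℝ) :
    ∑ H, F H = ∑ a, ∑ H : Fin N → α, F (Fin.cons a H : Fin (N + 1) → α) := by
  rw [← (Fin.consEquiv fun _ : Fin (N + 1) => α).sum_comp, Fintype.sum_prod_type]
  rfl

/-- Induction on the horizon, conditioning on the first cycle: the remaining cycles form the same
problem started from the next state. -/
theorem avgProfit_eq_birkhoffAverage (hlam1 : ∑ j, lam j = 1) (a : Fulfillment)
    (r : Fin (M + 1) → ℝ) (h : ℝ) (x : feasibleStates L S) (N : ℕ) :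
    avgProfit a lam r h T S (x : Fin L → ℕ) N =
      birkhoffAverage ℝ (markovOp (pathProb lam) (feasibleStep M T a)) _root_.id N
        (fun x : feasibleStates L S => expectedProfit a lam r h T (x : Fin L → ℕ)) x := by
  rw [avgProfit, birkhoffAverage, one_div, Pi.smul_apply, smul_eq_mul]
  congr 1
  induction N generalizing x with
  | zero => simp
  | succ N ih =>
    have hsucc : ∀ f : feasibleStates L S → ℝ,
        birkhoffSum (markovOp (pathProb lam) (feasibleStep M T a)) _root_.id (N + 1) f =
          f + markovOp (pathProb lam) (feasibleStep M T a)
            (birkhoffSum (markovOp (pathProb lam) (feasibleStep M T a)) _root_.id N f) := by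
      intro f
      rw [birkhoffSum_succ', birkhoffSum, birkhoffSum, map_sum]
      simp only [_root_.id, ← Function.iterate_succ_apply, ← Function.iterate_succ_apply']
    rw [hsucc, Pi.add_apply, markovOp_apply, expectedProfit, expect, ← Finset.sum_add_distrib,
      sum_eq_sum_cons]
    refine Finset.sum_congr rfl fun ω _ => ?_
    have h1 : cycleProfit a r h ((x : Fin L → ℕ) 0) ω =
        ∑ H : Fin N → CyclePath M T, (∏ n, pathProb lam (H n)) *
          cycleProfit a r h ((x : Fin L → ℕ) 0) ω := by
      rw [← Finset.sum_mul, sum_prod_pathProb hlam1 N, one_mul]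
    rw [← ih, ← mul_add, h1, ← Finset.sum_add_distrib, Finset.mul_sum]
    refine Finset.sum_congr rfl fun H _ => ?_
    rw [Fin.prod_univ_succ, Fin.sum_univ_succ]
    simp only [Fin.cons_zero, Fin.cons_succ, Fin.val_succ, stateAt_succ', extendPath_cons_zero,
      extendPath_cons_succ, Fin.val_zero, stateAt, feasibleStep]
    ring

/-- The time averages of the profit converge to the mean under a stationary law. -/
theorem exists_isStationaryLaw (hlam : ∀ j, 0 ≤ lam j) (hlam1 : ∑ j, lam j = 1) (T : ℕ)
    (a : Fulfillment) {z₀ : Fin L → ℕ} (hz₀ : z₀ ∈ feasibleStates L S) :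
    ∃ ν : (Fin L → ℕ) → ℝ, IsStationaryLaw a lam T S ν ∧ ∀ (r : Fin (M + 1) → ℝ) (h : ℝ), Tendsto (avgProfit a lam r h T S z₀) atTop
      (𝓝 (stateExpect S ν (expectedProfit a lam r h T))) := by
  classical
  obtain ⟨ν, h0, h1, hinv, hlim⟩ := exists_limit_law (step := feasibleStep M T a)
    (pathProb_nonneg hlam) (sum_pathProb hlam1) (⟨z₀, hz₀⟩ : feasibleStates L S)
  set ν' : (Fin L → ℕ) → ℝ := fun z => if hz : z ∈ feasibleStates L S then ν ⟨z, hz⟩ else 0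
  have hν' : ∀ x : feasibleStates L S, ν' x = ν x := fun x => dif_pos x.2
  refine ⟨ν', ⟨fun z => ?_, fun z hz => dif_neg hz, ?_, fun z' => ?_⟩,
    fun (r : Fin (M + 1) → ℝ) h => ?_⟩
  · simp only [ν']; split_ifs
    exacts [h0 _, le_rfl]
  · rw [sum_feasibleStates]; simp only [hν', h1]
  · have h2 := hinv fun x => if (x : Fin L → ℕ) = z' then 1 else 0
    have h3 : ∑ x : feasibleStates L S, ν x * (if (x : Fin L → ℕ) = z' then 1 else 0) = ν' z' := by
      simp only [← hν']
      rw [← sum_feasibleStates fun z => ν' z * if z = z' then 1 else 0]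
      by_cases hz' : z' ∈ feasibleStates L S
      · simp [hz']
      · simp [hz', ν']
    rw [← h3, ← h2, sum_feasibleStates]
    refine Finset.sum_congr rfl fun x _ => ?_
    rw [hν', markovOp_apply, transProb, Finset.sum_filter]
    congr 1
    refine Finset.sum_congr rfl fun ω _ => ?_
    by_cases hω : nextState a S x ω = z' <;> simp [feasibleStep, hω]
  · have h2 := hlim fun x => expectedProfit a lam r h T (x : Fin L → ℕ)
    rw [stateExpect, sum_feasibleStates]
    simp only [hν']
    exact h2.congr fun N => (avgProfit_eq_birkhoffAverage hlam1 a r h ⟨z₀, hz₀⟩ N).symm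

/-- After `L` cycles without arrivals the whole stock is on hand. -/
theorem iterate_feasibleStep_zero (a : Fulfillment) (x : feasibleStates L S) :
    (((feasibleStep M T a · fun _ => 0)^[L] x : feasibleStates L S) : Fin L → ℕ) =
      fun i => if i = 0 then S else 0 := by
  have harr : arrivals (fun _ => 0 : CyclePath M T) = ∅ := by simp [arrivals]
  -- After `k` cycles without sales, the last `k` places of the pipeline, place 0 excepted, are
  -- empty.
  have key : ∀ k, ∀ j : Fin (L + 1), j ≠ 0 → L < j + k →
      pipeline S ((feasibleStep M T a · fun _ => 0)^[k] x : feasibleStates L S) j = 0 := by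
    intro k
    induction k with
    | zero => intro j _ hj; omega
    | succ k ih =>
      intro j hj0 hj
      rw [Function.iterate_succ_apply']
      induction j using Fin.lastCases with
      | last =>
        rw [feasibleStep, pipeline_nextState_last a (Subtype.mem _), harr]
        simp
      | cast i =>
        have hi : i ≠ 0 := fun h => hj0 (by rw [h, Fin.castSucc_zero'])
        rw [feasibleStep, pipeline_nextState_castSucc a _ _ hi]
        refine ih _ (Fin.succ_ne_zero i) ?_
        simp only [Fin.val_castSucc, Fin.val_succ] at hj ⊢
        omega
  set y := (feasibleStep M T a · fun _ => 0)^[L] x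
  have hy : ∀ j : Fin (L + 1), j ≠ 0 → pipeline S y j = 0 := fun j hj =>
    key L j hj (by have := Nat.pos_of_ne_zero (Fin.val_ne_zero_iff.2 hj); omega)
  ext i
  split_ifs with hi
  · have h1 := sum_pipeline_succ y.2
    rw [Finset.sum_eq_zero fun j _ => hy _ (Fin.succ_ne_zero j)] at h1
    rw [hi]; omega
  · rw [← pipeline_castSucc (S := S) (y : Fin L → ℕ) i, hy]
    exact fun h => hi (Fin.castSucc_injective _ (by rw [h, Fin.castSucc_zero']))

/-- If periods without arrival are possible, the long-run average profit is the mean under every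
stationary law. -/
theorem tendsto_avgProfit_of_isStationaryLaw (hlam : ∀ j, 0 ≤ lam j) (hlam1 : ∑ j, lam j = 1)
    (h0 : 0 < lam 0) {a : Fulfillment} {ν : (Fin L → ℕ) → ℝ} (hν : IsStationaryLaw a lam T S ν)
    (r : Fin (M + 1) → ℝ) (h : ℝ) {z₀ : Fin L → ℕ} (hz₀ : z₀ ∈ feasibleStates L S) :
    Tendsto (avgProfit a lam r h T S z₀) atTop
      (𝓝 (stateExpect S ν (expectedProfit a lam r h T))) := by
  classical
  have hp := pathProb_nonneg (M := M) (T := T) hlam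
  have hp1 := sum_pathProb (M := M) (T := T) hlam1
  have hω : 0 < pathProb lam (fun _ => 0 : CyclePath M T) := by
    rw [pathProb]; exact Finset.prod_pos fun _ _ => h0
  -- The path without arrivals has positive weight, and `L` repetitions of it lead from all states
  -- to a common one, so fixed functions are constant.
  have hs : ∀ x : feasibleStates L S, (feasibleStep M T a · fun _ => 0)^[L] x =
      (feasibleStep M T a · fun _ => 0)^[L] ⟨z₀, hz₀⟩ := fun x =>
    Subtype.ext (by rw [iterate_feasibleStep_zero, iterate_feasibleStep_zero])
  have key := tendsto_birkhoffAverage_of_stationary hp hp1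
    (fun f hf => eq_of_markovOp_eq_self hp hp1 hω hs hf)
    (ν := fun x : feasibleStates L S => ν x) ?_ ?_
    (fun x => expectedProfit a lam r h T (x : Fin L → ℕ)) ⟨z₀, hz₀⟩
  · rw [stateExpect, sum_feasibleStates]
    exact key.congr fun N => (avgProfit_eq_birkhoffAverage hlam1 a r h ⟨z₀, hz₀⟩ N).symm
  · rw [← sum_feasibleStates]; exact hν.total
  · intro f
    set F : (Fin L → ℕ) → ℝ := fun z => if hz : z ∈ feasibleStates L S then f ⟨z, hz⟩ else 0
    have hF : ∀ x : feasibleStates L S, F x = f x := fun x => dif_pos x.2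
    have := stateExpect_nextState hν F
    rw [stateExpect, stateExpect, sum_feasibleStates, sum_feasibleStates] at this
    simp only [hF] at this
    rw [← this]
    refine Finset.sum_congr rfl fun x _ => ?_
    rw [markovOp_apply, expect]
    simp only [← hF]
    rfl

end

/-! ### Profit bounds under a stationary law -/

section

variable {M L T S : ℕ} {lam r : Fin (M + 1) → ℝ} {h : ℝ}

theorem slack_div (lam : Fin (M + 1) → ℝ) (T S : ℕ) :
    slack L lam T S / ((L : ℝ) + 1) = T * (1 - lam 0) - (S : ℝ) / ((L : ℝ) + 1) := by
  rw [slack]; field_simp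

variable [NeZero L]
  {a : Fulfillment} {ν : (Fin L → ℕ) → ℝ}

/-- Mean number of customers lost in a cycle when the state has law `ν`. -/
def meanLost (lam : Fin (M + 1) → ℝ) (T S : ℕ) (ν : (Fin L → ℕ) → ℝ) : ℝ :=
  stateExpect S ν fun z => expect lam fun ω : CyclePath M T => (((arrivals ω).card - z 0 : ℕ) : ℝ)

/-- Mean reward of all customers who arrive in a cycle. -/
def potentialReward (lam r : Fin (M + 1) → ℝ) (T : ℕ) : ℝ :=
  expect lam fun ω : CyclePath M T => ∑ t ∈ arrivals ω, r (ω t)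

theorem meanLost_nonneg (hlam : ∀ j, 0 ≤ lam j) (hlam1 : ∑ j, lam j = 1)
    (hν : IsStationaryLaw a lam T S ν) : 0 ≤ meanLost lam T S ν := by
  rw [← stateExpect_const hν 0]
  refine stateExpect_mono hν fun z _ => ?_
  rw [← expect_const (T := T) hlam1 0]
  exact expect_mono hlam fun ω => Nat.cast_nonneg _

/-- Lost customers are demand minus sales, and stationary sales are at most `S / (L + 1)`. -/
theorem le_meanLost (hlam : ∀ j, 0 ≤ lam j) (hlam1 : ∑ j, lam j = 1)
    (hν : IsStationaryLaw a lam T S ν) :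
    T * (1 - lam 0) - (S : ℝ) / ((L : ℝ) + 1) ≤ meanLost lam T S ν := by
  have h1 : meanLost lam T S ν = T * (1 - lam 0) -
      stateExpect S ν (fun z => expect lam fun ω : CyclePath M T =>
        ((min (z 0) (arrivals ω).card : ℕ) : ℝ)) := by
    rw [← stateExpect_const hν (T * (1 - lam 0)), ← stateExpect_sub, meanLost]
    congr 1
    ext z
    rw [← expect_card_arrivals hlam1, ← expect_sub]
    congr 1
    ext ω
    rw [eq_sub_iff_add_eq]
    norm_cast
    omega
  rw [h1]
  linarith [stationary_sales_le hν hlam hlam1]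

theorem stateExpect_expectedProfit_le (hlam : ∀ j, 0 ≤ lam j) (hr : StrictMono r) (hh : 0 < h)
    (hν : IsStationaryLaw a lam T S ν) (a' : Fulfillment) :
    stateExpect S ν (expectedProfit a' lam r h T) ≤
      potentialReward lam r T - r 1 * meanLost lam T S ν := by
  rw [meanLost, ← stateExpect_const_mul, ← stateExpect_const hν (potentialReward lam r T),
    ← stateExpect_sub]
  refine stateExpect_mono hν fun z _ => ?_
  rw [potentialReward, ← expect_const_mul, ← expect_sub, expectedProfit]
  refine expect_mono hlam fun ω => ?_
  have h1 := reward_le_of_lost hr a' (z 0) ω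
  have h2 : 0 ≤ h * (leftover a' (z 0) ω : ℝ) := by positivity
  rw [cycleProfit]
  linarith

/-- Lost customers and leftover units each number at most `|D - I| ≤ |D - m| + |I - m|`, at unit
costs of at most `r_M` and `h`. Concentration of `I` turns this into the factor `1 + L (L + 2)`. -/
theorem le_stateExpect_expectedProfit (hlam : ∀ j, 0 ≤ lam j)
    (hlam1 : ∑ j, lam j = 1) (hr0 : r 0 = 0) (hr : StrictMono r) (hh : 0 < h)
    (hν : IsStationaryLaw a lam T S ν) (a' : Fulfillment) :
    potentialReward lam r T - (r (Fin.last M) + h) * ((1 + L * (L + 2)) *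
        expect lam fun ω : CyclePath M T =>
          |((arrivals ω).card : ℝ) - (S : ℝ) / ((L : ℝ) + 1)|) ≤
      stateExpect S ν (expectedProfit a' lam r h T) := by
  set m : ℝ := (S : ℝ) / ((L : ℝ) + 1) with hm
  set b := expect lam (fun ω : CyclePath M T => |((arrivals ω).card : ℝ) - m|) with hb
  have hrM : 0 ≤ r (Fin.last M) := hr0 ▸ hr.monotone (Fin.le_last 0)
  have h1 : stateExpect S ν (fun z => potentialReward lam r T -
      (r (Fin.last M) + h) * (b + |(z 0 : ℝ) - m|)) ≤
      stateExpect S ν (expectedProfit a' lam r h T) := by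
    refine stateExpect_mono hν fun z _ => ?_
    rw [potentialReward, hb, ← expect_const (T := T) hlam1 |(z 0 : ℝ) - m|, ← expect_add,
      ← expect_const_mul, ← expect_sub, expectedProfit]
    refine expect_mono hlam fun ω => ?_
    have h2 := reward_ge_of_lost hr a' (z 0) ω
    have h3 := abs_sub_le ((arrivals ω).card : ℝ) m (z 0)
    rw [abs_sub_comm m] at h3
    have h4 : (((arrivals ω).card - z 0 : ℕ) : ℝ) ≤ |((arrivals ω).card : ℝ) - z 0| := by
      rcases le_total (arrivals ω).card (z 0) with hle | hle
      · rw [Nat.sub_eq_zero_of_le hle]; simp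
      · rw [Nat.cast_sub hle]; exact le_abs_self _
    have h5 : ((leftover a' (z 0) ω : ℕ) : ℝ) ≤ |((arrivals ω).card : ℝ) - z 0| := by
      rw [leftover_eq, abs_sub_comm]
      rcases le_total (z 0) (arrivals ω).card with hle | hle
      · rw [Nat.sub_eq_zero_of_le hle]; simp
      · rw [Nat.cast_sub hle]; exact le_abs_self _
    have h6 := mul_le_mul_of_nonneg_left (h4.trans h3) hrM
    have h7 := mul_le_mul_of_nonneg_left (h5.trans h3) hh.le
    rw [cycleProfit]
    linarith
  refine le_trans ?_ h1
  rw [stateExpect_sub, stateExpect_const_mul, stateExpect_add, stateExpect_const hν,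
    stateExpect_const hν]
  have h2 := meanAbsDev_le hν hlam hlam1
  have h3 : stateExpect S ν (fun z => |(z 0 : ℝ) - m|) = meanAbsDev S ν := rfl
  have h4 : b + meanAbsDev S ν ≤ (1 + L * (L + 2)) * b := by rw [← hm] at h2; linarith
  rw [h3]
  have h5 := mul_le_mul_of_nonneg_left h4 (add_nonneg hrM hh.le)
  linarith

theorem expect_abs_card_arrivals_sub_le_add (hlam : ∀ j, 0 ≤ lam j) (hlam1 : ∑ j, lam j = 1)
    (m : ℝ) :
    expect lam (fun ω : CyclePath M T => |((arrivals ω).card : ℝ) - m|) ≤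
      Real.sqrt ((1 - lam 0) * lam 0) * Real.sqrt T + |T * (1 - lam 0) - m| := by
  refine le_trans ?_ (add_le_add_left (expect_abs_card_arrivals_sub_le hlam hlam1) _)
  rw [← expect_const (T := T) hlam1 |T * (1 - lam 0) - m|, ← expect_add]
  exact expect_mono hlam fun ω => abs_sub_le _ _ _

/-- Stationary comparison of the two algorithms at the same base-stock level. -/
theorem stateExpect_offline_sub_greedy_le (hM : 2 ≤ M) (hlam : ∀ j, 0 ≤ lam j)
    (hlam1 : ∑ j, lam j = 1) (hr : StrictMono r) (h0 : lam 0 < 1)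
    (hν : IsStationaryLaw a lam T S ν) (hS : 0 ≤ slack L lam T S) {K₂ : ℝ}
    (hK : meanAbsDev S ν ≤ K₂ * Real.sqrt T) :
    stateExpect S ν (expectedProfit .offline lam r h T) -
      stateExpect S ν (expectedProfit .greedy lam r h T) ≤ gapBound L lam r T S K₂ := by
  have hμ : 0 < 1 - lam 0 := by linarith
  have hd : 0 ≤ r (Fin.last M) - r 1 := sub_nonneg.2 (hr.monotone (Fin.le_last _))
  have hq : 0 ≤ 1 - lam 0 - lam 1 := by
    rw [← sum_mul_ite_ne_zero_one hM hlam1]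
    refine Finset.sum_nonneg fun j _ => mul_nonneg (hlam j) ?_
    split_ifs <;> norm_num
  have h1 : stateExpect S ν (expectedProfit .offline lam r h T) -
      stateExpect S ν (expectedProfit .greedy lam r h T) ≤
      (r (Fin.last M) - r 1) * ((1 - lam 0 - lam 1) / (1 - lam 0)) * meanLost lam T S ν := by
    rw [← stateExpect_sub, meanLost, ← stateExpect_const_mul]
    refine stateExpect_mono hν fun z _ => ?_
    have h2 : expect lam (fun ω : CyclePath M T =>
        (((arrivals ω \ greedyAccepted (z 0) ω).filter fun t => ω t ≠ 1).card : ℝ)) =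
        (1 - lam 0 - lam 1) / (1 - lam 0) * expect lam (fun ω : CyclePath M T =>
        (((arrivals ω).card - z 0 : ℕ) : ℝ)) := by
      have := expect_lost_type (T := T) hM hlam1 (z 0)
      field_simp
      linarith
    rw [mul_assoc, ← h2, expectedProfit, expectedProfit, ← expect_sub, ← expect_const_mul]
    refine expect_mono hlam fun ω => ?_
    have h3 := offline_reward_sub_greedy_reward_le hr (z 0) ω
    simp only [cycleProfit, leftover_eq]
    simp only [accepted]
    linarith
  refine h1.trans ?_
  rw [gapBound]
  refine mul_le_mul_of_nonneg_left ?_ (mul_nonneg hd (div_nonneg hq hμ.le))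
  have hδ : 0 ≤ slack L lam T S / ((L : ℝ) + 1) := div_nonneg hS (by positivity)
  have h2 : meanLost lam T S ν ≤ Real.sqrt ((1 - lam 0) * lam 0) * Real.sqrt T +
      (slack L lam T S / ((L : ℝ) + 1) + meanAbsDev S ν) := by
    calc meanLost lam T S ν ≤ stateExpect S ν (fun z =>
          Real.sqrt ((1 - lam 0) * lam 0) * Real.sqrt T + (slack L lam T S / ((L : ℝ) + 1) +
            |(z 0 : ℝ) - (S : ℝ) / ((L : ℝ) + 1)|)) := by
          refine stateExpect_mono hν fun z _ => ?_
          refine le_trans ?_ (add_le_add_left (expect_abs_card_arrivals_sub_le hlam hlam1) _)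
          rw [← expect_const (T := T) hlam1 (slack L lam T S / ((L : ℝ) + 1) +
            |(z 0 : ℝ) - (S : ℝ) / ((L : ℝ) + 1)|), ← expect_add]
          -- With `m = S / (L + 1)`, a positive loss is split as `D - I = (D - T(1 - λ₀)) + (T(1 -
          -- λ₀) - m) + (m - I)`, whose middle term is `Δ / (L + 1)`; a zero loss needs only that
          -- the bound is nonnegative, whence the hypothesis on the slack.
          refine expect_mono hlam fun ω => ?_
          have h4 := le_abs_self (((arrivals ω).card : ℝ) - T * (1 - lam 0))
          have h5 := neg_abs_le ((z 0 : ℝ) - (S : ℝ) / ((L : ℝ) + 1))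
          have h6 := slack_div (L := L) lam T S
          rcases le_total (arrivals ω).card (z 0) with hle | hle
          · rw [Nat.sub_eq_zero_of_le hle, Nat.cast_zero]
            positivity
          · rw [Nat.cast_sub hle]; linarith
      _ = _ := by
          rw [stateExpect_add, stateExpect_add, stateExpect_const hν, stateExpect_const hν]
          rfl
  linarith

end

/-! ### Consequences of optimality of the base-stock level -/

section

variable {M L : ℕ} {lam r : Fin (M + 1) → ℝ} {h : ℝ}

theorem Interior.slack_pos {T S : ℕ} (hI : Interior L lam T S) : 0 < slack L lam T S := by
  rw [slack]; linarith [hI.2]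

theorem Interior.one_le {T S : ℕ} (hI : Interior L lam T S) : 1 ≤ T := by
  rcases Nat.eq_zero_or_pos T with rfl | h
  · have := hI.1.trans hI.2
    simp at this
  · exact h

theorem Interior.lam_lt_one {T S : ℕ} (hI : Interior L lam T S) : lam 0 < 1 := by
  have h1 := (Nat.cast_nonneg (α := ℝ) S).trans_lt hI.2
  by_contra h
  have h2 : 0 ≤ ((L : ℝ) + 1) * T * (lam 0 - 1) :=
    mul_nonneg (by positivity) (by linarith)
  linarith

variable [NeZero L]

theorem longRunProfit_eq {T S : ℕ} {a : Fulfillment} {z₀ : Fin L → ℕ} {c : ℝ}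
    (hc : Tendsto (avgProfit a lam r h T S z₀) atTop (𝓝 c)) :
    longRunProfit a lam r h T S z₀ = c :=
  hc.limUnder_eq

theorem lam_le_one (hlam : ∀ j, 0 ≤ lam j) (hlam1 : ∑ j, lam j = 1) : lam 0 ≤ 1 := by
  rw [← hlam1]
  exact Finset.single_le_sum (fun j _ => hlam j) (Finset.mem_univ 0)

theorem longRunProfit_le_potentialReward {T S : ℕ} (hlam : ∀ j, 0 ≤ lam j)
    (hlam1 : ∑ j, lam j = 1) (hr0 : r 0 = 0) (hr : StrictMono r) (hh : 0 < h)
    (a : Fulfillment) {z₀ : Fin L → ℕ} (hz₀ : z₀ ∈ feasibleStates L S) :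
    longRunProfit a lam r h T S z₀ ≤ potentialReward lam r T := by
  obtain ⟨ν, hν, hlim⟩ := exists_isStationaryLaw hlam hlam1 T a hz₀
  have h1 := stateExpect_expectedProfit_le hlam hr hh hν a
  have h2 : 0 ≤ r 1 := hr0 ▸ hr.monotone (Fin.zero_le 1)
  have h3 := mul_nonneg h2 (meanLost_nonneg hlam hlam1 hν)
  rw [longRunProfit_eq (hlim r h)]
  linarith

/-- Long-run profit lost by the base-stock level `⌊(L + 1) T (1 - λ₀)⌋` is of the order of the
fluctuations. -/
theorem exists_level_le_longRunProfit (hlam : ∀ j, 0 ≤ lam j)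
    (hlam1 : ∑ j, lam j = 1) (hr0 : r 0 = 0) (hr : StrictMono r) (hh : 0 < h)
    (a : Fulfillment) (T : ℕ) {init : ℕ → Fin L → ℕ} (hinit : ∀ S, init S ∈ feasibleStates L S) :
    ∃ S, ∃ e : ℝ, 0 ≤ e ∧ e ≤ 1 ∧ (lam 0 = 0 → e = 0) ∧
      potentialReward lam r T - (r (Fin.last M) + h) * (1 + L * (L + 2)) *
        (Real.sqrt ((1 - lam 0) * lam 0) * Real.sqrt T + e) ≤
          longRunProfit a lam r h T S (init S) := by
  have hμ : 0 ≤ 1 - lam 0 := sub_nonneg.2 (lam_le_one hlam hlam1)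
  have hL : (0 : ℝ) < (L : ℝ) + 1 := by positivity
  have hx : 0 ≤ ((L : ℝ) + 1) * T * (1 - lam 0) := by positivity
  set S := ⌊((L : ℝ) + 1) * T * (1 - lam 0)⌋₊ with hS
  have hS1 : (S : ℝ) ≤ ((L : ℝ) + 1) * T * (1 - lam 0) := Nat.floor_le hx
  have hS2 : ((L : ℝ) + 1) * T * (1 - lam 0) < S + 1 := Nat.lt_floor_add_one _
  have hd : T * (1 - lam 0) - (S : ℝ) / ((L : ℝ) + 1) = slack L lam T S / ((L : ℝ) + 1) :=
    (slack_div lam T S).symm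
  have hs0 : 0 ≤ slack L lam T S / ((L : ℝ) + 1) :=
    div_nonneg (by rw [slack]; linarith) hL.le
  -- The error `e` is the rounding loss of the floor. It vanishes for `λ₀ = 0`, where `(L + 1) T` is
  -- already an integer.
  refine ⟨S, slack L lam T S / ((L : ℝ) + 1), hs0, ?_, fun h0 => ?_, ?_⟩
  · rw [div_le_one hL, slack]
    have : (0 : ℝ) ≤ L := Nat.cast_nonneg L
    linarith
  · have : S = (L + 1) * T := by
      rw [hS, h0, sub_zero, mul_one, ← Nat.floor_natCast (R := ℝ) ((L + 1) * T)]
      push_cast; rfl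
    rw [slack, this, h0]; push_cast; ring
  · obtain ⟨ν, hν, hlim⟩ := exists_isStationaryLaw hlam hlam1 T a (hinit S)
    rw [longRunProfit_eq (hlim r h)]
    refine le_trans ?_ (le_stateExpect_expectedProfit hlam hlam1 hr0 hr hh hν a)
    have h1 := expect_abs_card_arrivals_sub_le_add (T := T) hlam hlam1 ((S : ℝ) / ((L : ℝ) + 1))
    rw [hd, abs_of_nonneg hs0] at h1
    have hrM : 0 ≤ r (Fin.last M) := hr0 ▸ hr.monotone (Fin.le_last 0)
    have h2 := mul_le_mul_of_nonneg_left h1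
      (show 0 ≤ (r (Fin.last M) + h) * (1 + L * (L + 2)) by positivity)
    linarith

/-- The optimal profit of a level is within the order of the fluctuations of the mean reward of
all customers. -/
theorem IsOptimalLevel.potentialReward_sub_le (hlam : ∀ j, 0 ≤ lam j)
    (hlam1 : ∑ j, lam j = 1) (hr0 : r 0 = 0) (hr : StrictMono r) (hh : 0 < h)
    {a : Fulfillment} {T S : ℕ} {init : ℕ → Fin L → ℕ}
    (hinit : ∀ S, init S ∈ feasibleStates L S) (hS : IsOptimalLevel a lam r h T init S) :
    ∃ e : ℝ, 0 ≤ e ∧ e ≤ 1 ∧ (lam 0 = 0 → e = 0) ∧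
      potentialReward lam r T - (r (Fin.last M) + h) * (1 + L * (L + 2)) *
        (Real.sqrt ((1 - lam 0) * lam 0) * Real.sqrt T + e) ≤
          longRunProfit a lam r h T S (init S) := by
  obtain ⟨S', e, h0, h1, h2, h3⟩ :=
    exists_level_le_longRunProfit hlam hlam1 hr0 hr hh a T hinit
  exact ⟨e, h0, h1, h2, h3.trans (hS S')⟩

/-- Each unit of mean loss costs at least `r_1`, so a slack beyond the fluctuation scale would make
the level worse than the one in `exists_level_le_longRunProfit`. -/
theorem IsOptimalLevel.slack_le (hlam : ∀ j, 0 ≤ lam j)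
    (hlam1 : ∑ j, lam j = 1) (hr0 : r 0 = 0) (hr : StrictMono r) (hh : 0 < h)
    {a : Fulfillment} {T S : ℕ} {init : ℕ → Fin L → ℕ} (hinit : ∀ S, init S ∈ feasibleStates L S)
    (hS : IsOptimalLevel a lam r h T init S) :
    ∃ e : ℝ, 0 ≤ e ∧ e ≤ 1 ∧ (lam 0 = 0 → e = 0) ∧
      r 1 * (slack L lam T S / ((L : ℝ) + 1)) ≤ (r (Fin.last M) + h) * (1 + L * (L + 2)) *
        (Real.sqrt ((1 - lam 0) * lam 0) * Real.sqrt T + e) := by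
  obtain ⟨e, h0, h1, h2, h3⟩ := hS.potentialReward_sub_le hlam hlam1 hr0 hr hh hinit
  refine ⟨e, h0, h1, h2, ?_⟩
  obtain ⟨ν, hν, hlim⟩ := exists_isStationaryLaw hlam hlam1 T a (hinit S)
  rw [longRunProfit_eq (hlim r h)] at h3
  have h4 := stateExpect_expectedProfit_le hlam hr hh hν a
  have h5 := mul_le_mul_of_nonneg_left (le_meanLost hlam hlam1 hν)
    (show 0 ≤ r 1 from hr0 ▸ hr.monotone (Fin.zero_le 1))
  rw [slack_div]
  linarith

theorem sqrt_variance_le_one (hlam : ∀ j, 0 ≤ lam j) (hlam1 : ∑ j, lam j = 1) :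
    Real.sqrt ((1 - lam 0) * lam 0) ≤ 1 := by
  rw [Real.sqrt_le_one]
  nlinarith [hlam 0, lam_le_one hlam hlam1]

theorem fluctuation_le {T : ℕ} (hT : 1 ≤ T) (hlam : ∀ j, 0 ≤ lam j) (hlam1 : ∑ j, lam j = 1)
    {e : ℝ} (he : e ≤ 1) :
    Real.sqrt ((1 - lam 0) * lam 0) * Real.sqrt T + e ≤ 2 * Real.sqrt T := by
  have h1 : 1 ≤ Real.sqrt T := Real.one_le_sqrt.2 (by exact_mod_cast hT)
  have h2 := mul_le_mul_of_nonneg_right (sqrt_variance_le_one hlam hlam1) (Real.sqrt_nonneg T)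
  linarith

/-- For `λ₀ = 0` demand is deterministic and the comparison level is exact, so the bound on the
slack has right side 0, contradicting the positive slack of the interior regime. -/
theorem IsOptimalLevel.lam_zero_pos (hM : 2 ≤ M) (hlam : ∀ j, 0 ≤ lam j)
    (hlam1 : ∑ j, lam j = 1) (hr0 : r 0 = 0) (hr : StrictMono r) (hh : 0 < h)
    {a : Fulfillment} {T S : ℕ} {init : ℕ → Fin L → ℕ} (hinit : ∀ S, init S ∈ feasibleStates L S)
    (hS : IsOptimalLevel a lam r h T init S) (hI : Interior L lam T S) : 0 < lam 0 := by
  refine lt_of_le_of_ne (hlam 0) fun h0 => ?_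
  obtain ⟨e, -, -, he, hle⟩ := hS.slack_le hlam hlam1 hr0 hr hh hinit
  rw [he h0.symm, ← h0] at hle
  have : NeZero M := ⟨by omega⟩
  have h1 : 0 < r 1 := hr0 ▸ hr Fin.one_pos'
  have h2 : 0 < r 1 * (slack L lam T S / ((L : ℝ) + 1)) :=
    mul_pos h1 (div_pos hI.slack_pos (by positivity))
  simp at hle
  linarith

end

end BaseStock

end

/-! ### Assembly of the theorem -/

open BaseStock
theorem mainTheorem5 (M L : ℕ) (hM : 2 ≤ M) [NeZero L]
    (lam r : Fin (M + 1) → ℝ) (h : ℝ)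
    (hlam : ∀ j, 0 ≤ lam j) (hlam_sum : ∑ j, lam j = 1)
    -- `r 0 = 0` is the convention for periods without arrival, so `0 < r 1 < ⋯ < r M`
    (hr0 : r 0 = 0) (hr : StrictMono r) (hh : 0 < h)
    -- arbitrary feasible initial states
    (init : Fulfillment → ℕ → ℕ → Fin L → ℕ)
    (hinit : ∀ a T S, init a T S ∈ feasibleStates L S)
    -- optimal base-stock levels
    (Soff Sgreedy : ℕ → ℕ)
    (hoff : ∀ T, 1 ≤ T →
      IsOptimalLevel .offline lam r h T (init .offline T) (Soff T))
    (hgreedy : ∀ T, 1 ≤ T →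
      IsOptimalLevel .greedy lam r h T (init .greedy T) (Sgreedy T)) :
    -- the long-run averages are limits
    (∀ a T S, 1 ≤ T → Tendsto (avgProfit a lam r h T S (init a T S)) atTop
      (𝓝 (longRunProfit a lam r h T S (init a T S)))) ∧
    -- a concentration constant independent of `T` exists, and the gap bound holds with it
    (∃ K₂ : ℝ, ∀ T, Interior L lam T (Soff T) →
      (∀ a, (∃ ν : (Fin L → ℕ) → ℝ, IsStationaryLaw a lam T (Soff T) ν) ∧
        ∀ ν : (Fin L → ℕ) → ℝ, IsStationaryLaw a lam T (Soff T) ν →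
          meanAbsDev (Soff T) ν ≤ K₂ * Real.sqrt T) ∧
      longRunProfit .offline lam r h T (Soff T) (init .offline T (Soff T)) -
        longRunProfit .greedy lam r h T (Sgreedy T) (init .greedy T (Sgreedy T)) ≤
          gapBound L lam r T (Soff T) K₂) ∧
    -- the gap bound holds with every valid concentration constant
    (∀ T, Interior L lam T (Soff T) → ∀ (a : Fulfillment) (ν : (Fin L → ℕ) → ℝ) (K₂ : ℝ),
      IsStationaryLaw a lam T (Soff T) ν →
      meanAbsDev (Soff T) ν ≤ K₂ * Real.sqrt T →
      longRunProfit .offline lam r h T (Soff T) (init .offline T (Soff T)) -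
        longRunProfit .greedy lam r h T (Sgreedy T) (init .greedy T (Sgreedy T)) ≤
          gapBound L lam r T (Soff T) K₂) ∧
    -- order of growth
    (∀ β ∈ Set.Icc (0 : ℝ) 1, (∀ᶠ T in atTop, Interior L lam T (Soff T)) →
      ((fun T : ℕ => slack L lam T (Soff T)) =Θ[atTop] fun T : ℕ => (T : ℝ) ^ β) →
      (fun T : ℕ => longRunProfit .offline lam r h T (Soff T) (init .offline T (Soff T)) -
        longRunProfit .greedy lam r h T (Sgreedy T) (init .greedy T (Sgreedy T)))
        =O[atTop] fun T : ℕ => (T : ℝ) ^ β + Real.sqrt T) := by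
  have : NeZero M := ⟨by omega⟩
  have hr1 : 0 < r 1 := hr0 ▸ hr Fin.one_pos'
  have hrM : 0 ≤ r (Fin.last M) := hr0 ▸ hr.monotone (Fin.le_last 0)
  set C : ℝ := (r (Fin.last M) + h) * (1 + L * (L + 2)) with hC
  have hC0 : 0 ≤ C := by positivity
  have gap : ∀ T, Interior L lam T (Soff T) →
      ∀ (a : Fulfillment) (ν : (Fin L → ℕ) → ℝ) (K₂ : ℝ), IsStationaryLaw a lam T (Soff T) ν →
      meanAbsDev (Soff T) ν ≤ K₂ * Real.sqrt T →
      longRunProfit .offline lam r h T (Soff T) (init .offline T (Soff T)) -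
        longRunProfit .greedy lam r h T (Sgreedy T) (init .greedy T (Sgreedy T)) ≤
          gapBound L lam r T (Soff T) K₂ := by
    intro T hI a ν K₂ hν hK
    -- Positivity of `λ₀` identifies both long-run profits at `Soff` with means under the given `ν`,
    -- whichever algorithm it came from and whatever the initial states.
    have h0 := (hoff T hI.one_le).lam_zero_pos hM hlam hlam_sum hr0 hr hh
      (fun S => hinit .offline T S) hI
    have h1 := longRunProfit_eq (tendsto_avgProfit_of_isStationaryLaw hlam hlam_sum h0
      (hν.of_fulfillment .offline) r h (hinit .offline T (Soff T)))
    have h2 := longRunProfit_eq (tendsto_avgProfit_of_isStationaryLaw hlam hlam_sum h0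
      (hν.of_fulfillment .greedy) r h (hinit .greedy T (Soff T)))
    have h3 := hgreedy T hI.one_le (Soff T)
    have h4 := stateExpect_offline_sub_greedy_le (h := h) hM hlam hlam_sum hr hI.lam_lt_one hν
      hI.slack_pos.le hK
    rw [h2] at h3
    rw [h1]
    linarith
  -- `L (L + 2)` is the concentration factor; `2 * C / r 1` bounds `Δ / (L + 1)` and 1 bounds the
  -- standard deviation of demand, both in units of `√T`.
  set K : ℝ := L * (L + 2) * (2 * C / r 1 + 1) with hKdef
  have conc : ∀ T, Interior L lam T (Soff T) → ∀ (a : Fulfillment) (ν : (Fin L → ℕ) → ℝ),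
      IsStationaryLaw a lam T (Soff T) ν → meanAbsDev (Soff T) ν ≤ K * Real.sqrt T := by
    intro T hI a ν hν
    obtain ⟨e, -, he, -, hle⟩ := (hoff T hI.one_le).slack_le hlam hlam_sum hr0 hr hh
      (fun S => hinit .offline T S)
    have hδ : 0 < slack L lam T (Soff T) / ((L : ℝ) + 1) := div_pos hI.slack_pos (by positivity)
    have h1 := mul_le_mul_of_nonneg_left (fluctuation_le hI.one_le hlam hlam_sum he) hC0
    have h2 : slack L lam T (Soff T) / ((L : ℝ) + 1) ≤ 2 * C / r 1 * Real.sqrt T := by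
      rw [div_mul_eq_mul_div, le_div_iff₀ hr1]
      linarith
    have h3 := expect_abs_card_arrivals_sub_le_add (T := T) hlam hlam_sum
      ((Soff T : ℝ) / ((L : ℝ) + 1))
    rw [← slack_div, abs_of_pos hδ] at h3
    have h4 := mul_le_mul_of_nonneg_right (sqrt_variance_le_one hlam hlam_sum)
      (Real.sqrt_nonneg T)
    refine (meanAbsDev_le hν hlam hlam_sum).trans ?_
    rw [hKdef, mul_assoc ((L : ℝ) * (L + 2))]
    refine mul_le_mul_of_nonneg_left (h3.trans ?_) (by positivity)
    rw [add_mul]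
    linarith
  have exist : ∀ T a, ∃ ν : (Fin L → ℕ) → ℝ, IsStationaryLaw a lam T (Soff T) ν := by
    intro T a
    obtain ⟨ν, hν, -⟩ := exists_isStationaryLaw hlam hlam_sum T a (hinit a T (Soff T))
    exact ⟨ν, hν⟩
  have gapK : ∀ T, Interior L lam T (Soff T) →
      longRunProfit .offline lam r h T (Soff T) (init .offline T (Soff T)) -
        longRunProfit .greedy lam r h T (Sgreedy T) (init .greedy T (Sgreedy T)) ≤
          gapBound L lam r T (Soff T) K := by
    intro T hI
    obtain ⟨ν, hν⟩ := exist T .offline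
    exact gap T hI .offline ν K hν (conc T hI .offline ν hν)
  refine ⟨fun a T S _ => ?_, ⟨K, fun T hI => ⟨fun a => ⟨exist T a, conc T hI a⟩, gapK T hI⟩⟩,
    gap, fun β _ hI hΘ => ?_⟩
  · obtain ⟨ν, -, hlim⟩ := exists_isStationaryLaw hlam hlam_sum T a (hinit a T S)
    rw [longRunProfit_eq (hlim r h)]
    exact hlim r h
  · have hB : (fun T : ℕ => slack L lam T (Soff T)) =O[atTop]
        fun T : ℕ => (T : ℝ) ^ β + Real.sqrt T := by
      refine hΘ.1.trans (IsBigO.of_bound 1 (Eventually.of_forall fun T => ?_))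
      have h1 : 0 ≤ (T : ℝ) ^ β := by positivity
      rw [Real.norm_of_nonneg h1, Real.norm_of_nonneg (by positivity)]
      linarith [Real.sqrt_nonneg T]
    have hQ : (fun T : ℕ => Real.sqrt T) =O[atTop]
        fun T : ℕ => (T : ℝ) ^ β + Real.sqrt T := by
      refine IsBigO.of_bound 1 (Eventually.of_forall fun T => ?_)
      have h1 : 0 ≤ (T : ℝ) ^ β := by positivity
      rw [Real.norm_of_nonneg (Real.sqrt_nonneg _), Real.norm_of_nonneg (by positivity)]
      linarith
    have hG : (fun T : ℕ => gapBound L lam r T (Soff T) K) =O[atTop]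
        fun T : ℕ => (T : ℝ) ^ β + Real.sqrt T := by
      simp only [gapBound, div_eq_mul_inv (slack L lam _ _), mul_comm (slack L lam _ _)]
      exact ((hB.const_mul_left _).add (hQ.const_mul_left _)).const_mul_left _
    -- The two-sided estimate also needs a lower bound on the gap: the greedy optimum is at most the
    -- mean reward of all arrivals, and the offline optimum falls short of it by at most `2 * C *
    -- √T`.
    refine IsBigO.trans ?_ (hG.norm_left.add (hQ.const_mul_left (2 * C)))
    refine IsBigO.of_bound 1 ?_
    filter_upwards [hI] with T hT
    obtain ⟨e, -, he, -, hle⟩ := (hoff T hT.one_le).potentialReward_sub_le hlam hlam_sum hr0 hr hh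
      (fun S => hinit .offline T S)
    have h1 := mul_le_mul_of_nonneg_left (fluctuation_le hT.one_le hlam hlam_sum he) hC0
    have h2 := longRunProfit_le_potentialReward (T := T) hlam hlam_sum hr0 hr hh .greedy
      (hinit .greedy T (Sgreedy T))
    have h3 := (gapK T hT).trans (Real.le_norm_self _)
    have h4 : 0 ≤ 2 * C * Real.sqrt T := by positivity
    have h5 := norm_nonneg (gapBound L lam r T (Soff T) K)
    rw [one_mul, Real.norm_of_nonneg (add_nonneg h5 h4), Real.norm_eq_abs, abs_le]
    constructor <;> linarith
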